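/- **Theorem.** Let $\Sigma$ be a finite alphabet, $L\subseteq\Sigma^*$ a regular language and $\epsilon>0$. Then the dynamic problem $\mathrm{RangeMember}(L)$ can be maintained in DynFO with work $O(n^{\epsilon})$ per query and change operation. That is, there is a procedural dynamic first-order program $\mathcal P$ (one program for all $n$, possibly depending on $L$ and $\epsilon$) for $\mathrm{RangeMember}(L)$ such that the work of every change operation and of every query operation of $\mathcal P$, as a function of the domain size $n$, is in $O(n^{\epsilon})$. The notions are as follows. *The dynamic problem.* For each $n$, the states of $\mathrm{RangeMember}(L)$ on the domain $[n]=\{0,\dots,n-1\}$ are the sequences $w_0\dots w_{n-1}$ with $w_i\in\Sigma\cup\{\varepsilon\}$ ($\varepsilon$ the empty word); initially all $w_i=\varepsilon$. The change operations are $\mathrm{set}_\sigma(i)$ for $\sigma\in\Sigma$ (sets $w_i$ to $\sigma$ if $w_i=\varepsilon$, and has no effect otherwise) and $\mathrm{reset}(i)$ (sets $w_i$ to $\varepsilon$). The query operation $\mathrm{range}(\ell,r)$ asks whether $w_\ell\circ\dots\circ w_r\in L$ (for $\ell>r$ this is the empty word). *Programs.* A program has a finite auxiliary schema of relation symbols and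 (partial) function symbols, interpreted over the domain $[n]$, and finitely many supplementary instances over $[n]$, each with a program of its own (nested to a finite depth). Each auxiliary relation and each graph of an auxiliary function is initialized by a fixed first-order formula over $([n],\le,+,\times)$. *Terms* are built from operation parameters, index variables, local variables, $\bot$, the partial operations $+,\times$ of $[n]$, auxiliary functions, functions assigned before in the procedure, if-then-else terms, functional queries to supplementary instances, and $\mathbf{unique}\ z\le g(n)\,(C)$, for which exactly one witness is required whenever it is evaluated. *Conditions* are built from $\mathrm{true}$, equalities and inequalities of terms, atoms with auxiliary relations or relations assigned before, and relational queries to supplementary instances, by Boolean operations and $\mathbf{exists}\ z\le g(n)\,(C)$. Atoms and relational queries with undefined arguments are false, functions and functional queries with undefined arguments are $\bot$, and assignments and change invocations with undefined arguments have no effect. All bounds $g:\mathbb N\to\mathbb N$ are first-order definable: one formula defines $\{z\in[n]: z\le g(n)\}$ in $([n],\le,+,\times)$ for every $n$. *Instructions* are assignments to non-auxiliary functions or relations, series of instructions, conditional branches, and parallel branches $\mathbf{for}\ z\le g(n)\ \mathbf{do}$; every assignment inside a parallel branch has the bound variable $z$ among the arguments on its left-hand side, and different branches may write to the same position only the same value.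 For each change operation and each auxiliary symbol there is one update rule, consisting of an initial procedure $P_1$ (which may also invoke change operations of supplementary instances, outside parallel branches), a tuple of index variables $\bar x$ with bounds $x_j\le g_j(n)$, a tuple of target terms over the auxiliary schema, and a main procedure $P_2$, every execution path of which ends in a return statement (outside parallel branches). $P_1$ is executed once on the old state; then, for each $\bar x$ within the bounds, the auxiliary symbol is updated at the position given by the target terms to the value returned by $P_2$ (positions with an undefined coordinate are ignored; a relation is true at an updated position iff some $\bar x$ with this target returns true; for a function, all $\bar x$ with the same target have to return the same value). All other positions are unchanged, and all rules are evaluated on the old state. For each change operation and supplementary instance, at most one update rule invokes changes of this instance. A query operation is answered by a main procedure without index variables. $\mathcal P$ is a program for a dynamic problem if, for every $n$ and after every sequence of change operations from the initial states, every operation can be executed without violating these requirements, and every query gives the correct result. *Work.* For fixed $n$, constants, variables and $\mathrm{true}$ have work $1$. The work of a composed term, condition, instruction or procedure (including return statements) is the maximum of $1$ and the works of its constituents, except that $\mathbf{unique}\ z\le g(n)\,(C)$, $\mathbf{exists}\ z\le g(n)\,(C)$ and $\mathbf{for}\ z\le g(n)\ \mathbf{do}\ P$ have $g(n)+1$ times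 the work of $C$ or $P$, respectively, and a query or change invocation at a supplementary instance also includes, in the maximum, the work of that operation of the instance's program. The work of an update rule is $\max\bigl(w(P_1),\ \prod_j (g_j(n)+1)\cdot\max(w(P_2),w(\text{target terms}))\bigr)$. The work of a change operation is the maximum over its update rules; the work of a query operation is that of its query procedure. -/

import Mathlib

/-!
# Dynamic problems and procedural first-order dynamic programs with work bounds
-/

universe u v

namespace DynFO

/-! ## First-order logic with arithmetic on the domain `[n] = {0, …, n-1}` -/

/-- The relation symbols of first-order logic over `[n]`: the linear order, and the graphs of
addition and multiplication. -/
inductive ArithRel : ℕ → Type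
  | le : ArithRel 2
  | add : ArithRel 3
  | mul : ArithRel 3

/-- The first-order language with `≤`, `+` and `×` (the latter two as ternary relations, since the
operations are partial on `[n]`). -/
def arith : FirstOrder.Language.{0, 0} := ⟨fun _ => Empty, ArithRel⟩

instance arithStructure (n : ℕ) : arith.Structure (Fin n) where
  funMap := fun f => Empty.elim f
  RelMap := fun {_} r =>
    match r with
    | .le => fun x => x 0 ≤ x 1
    | .add => fun x => (x 0 : ℕ) + (x 1 : ℕ) = (x 2 : ℕ)
    | .mul => fun x => (x 0 : ℕ) * (x 1 : ℕ) = (x 2 : ℕ)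

/-- A function `g : ℕ → ℕ` is first-order definable from `+` and `×` if one fixed formula defines,
in every `[n]`, the set of elements `z` with `z ≤ g n`. -/
def FODefinable (g : ℕ → ℕ) : Prop :=
  ∃ φ : arith.Formula (Fin 1), ∀ (n : ℕ) (z : Fin n), φ.Realize (fun _ => z) ↔ (z : ℕ) ≤ g n

/-- The first-order definable bounds `g` that may occur in `z ≤ g(n)`. -/
abbrev Bound : Type := {g : ℕ → ℕ // FODefinable g}

/-! ## Schemas, structures, dynamic problems -/

/-- A schema: finitely many relation and function symbols, with arities. -/
structure Schema where
  Rel : Type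
  Fun : Type
  relArity : Rel → ℕ
  funArity : Fun → ℕ
  [fintypeRel : Fintype Rel]
  [fintypeFun : Fintype Fun]

attribute [instance] Schema.fintypeRel Schema.fintypeFun

/-- The schema without symbols. -/
def Schema.empty : Schema where
  Rel := Empty
  Fun := Empty
  relArity := fun r => r.elim
  funArity := fun f => f.elim

/-- A structure over a schema with domain `[n]`. Functions are partial, `none` is `⊥`. -/
structure Str (σ : Schema) (n : ℕ) where
  rel : (R : σ.Rel) → (Fin (σ.relArity R) → Fin n) → Prop
  fn : (f : σ.Fun) → (Fin (σ.funArity f) → Fin n) → Option (Fin n)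

/-- The operations of a dynamic problem: finitely many change operations, relational queries and
functional queries. Each operation takes a tuple of domain elements. -/
structure OpSig where
  Change : Type u
  changeArity : Change → ℕ
  RelQuery : Type u
  relArity : RelQuery → ℕ
  FunQuery : Type u
  funArity : FunQuery → ℕ
  [finiteChange : Finite Change]
  [finiteRelQuery : Finite RelQuery]
  [finiteFunQuery : Finite FunQuery]

attribute [instance] OpSig.finiteChange OpSig.finiteRelQuery OpSig.finiteFunQuery

/-- A data type over the domain `[n]` with the given operations: its states, the initial state, and
the effect of the operations. -/
structure DataType (S : OpSig.{u}) (n : ℕ) where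
  State : Type v
  init : State
  change : (c : S.Change) → (Fin (S.changeArity c) → Fin n) → State → State
  relQuery : (q : S.RelQuery) → (Fin (S.relArity q) → Fin n) → State → Prop
  funQuery : (q : S.FunQuery) → (Fin (S.funArity q) → Fin n) → State → Option (Fin n)

/-- The state that a sequence of change operations leads to, from the initial state. -/
def DataType.run {S : OpSig.{u}} {n : ℕ} (D : DataType.{u, v} S n)
    (ops : List ((c : S.Change) × (Fin (S.changeArity c) → Fin n))) : D.State :=
  ops.foldl (fun s op => D.change op.1 op.2 s) D.init

/-- A dynamic problem: for every domain `[n]`, a data type, with the empty structure as its initial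
state. -/
abbrev DynProblem (S : OpSig.{u}) := (n : ℕ) → DataType.{u, v} S n

/-- What the execution of a dynamic program on the domain `[n]` consists of: a data type, the
information which operations can be executed in which state without violating a requirement of the
programming language (`…Ok`), and the work of each operation. -/
structure Execution (S : OpSig.{u}) (n : ℕ) extends DataType.{u, 0} S n where
  changeOk : (c : S.Change) → (Fin (S.changeArity c) → Fin n) → State → Prop
  relQueryOk : (q : S.RelQuery) → (Fin (S.relArity q) → Fin n) → State → Prop
  funQueryOk : (q : S.FunQuery) → (Fin (S.funArity q) → Fin n) → State → Prop
  changeWork : S.Change → ℕ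
  relQueryWork : S.RelQuery → ℕ
  funQueryWork : S.FunQuery → ℕ

/-! ## Syntax of terms and conditions -/

/-- The symbols that the procedures of a dynamic program can use: the auxiliary schema, the symbols
that are assigned inside procedures (disjoint from the auxiliary ones), and the finitely many
supplementary instances of other dynamic problems. -/
structure Ctx where
  aux : Schema
  tmp : Schema
  Inst : Type
  sig : Inst → OpSig.{u}
  [finiteInst : Finite Inst]

attribute [instance] Ctx.finiteInst

/-- The part of the symbols that consists of the auxiliary schema only. -/
def Ctx.auxOnly (C : Ctx.{u}) : Ctx.{u} where
  aux := C.aux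
  tmp := Schema.empty
  Inst := Empty
  sig := fun i => i.elim

mutual

/-- Terms with `p` operation parameters, `l` index variables (the tuple `x̄` of an update rule) and
`k` local variables. A binder in the scope of `k` local variables binds the local variable
number `k`, which is `Fin.last k` in its body. -/
inductive Term (C : Ctx.{u}) (p l : ℕ) : ℕ → Type u
  | undef {k : ℕ} : Term C p l k
  | param {k : ℕ} (i : Fin p) : Term C p l k
  | index {k : ℕ} (i : Fin l) : Term C p l k
  | loc {k : ℕ} (i : Fin k) : Term C p l k
  | add {k : ℕ} (s t : Term C p l k) : Term C p l k
  | mul {k : ℕ} (s t : Term C p l k) : Term C p l k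
  | aux {k : ℕ} (f : C.aux.Fun) (ts : Fin (C.aux.funArity f) → Term C p l k) : Term C p l k
  | tmp {k : ℕ} (f : C.tmp.Fun) (ts : Fin (C.tmp.funArity f) → Term C p l k) : Term C p l k
  | ite {k : ℕ} (c : Cond C p l k) (s t : Term C p l k) : Term C p l k
  | query {k : ℕ} (i : C.Inst) (q : (C.sig i).FunQuery)
      (ts : Fin ((C.sig i).funArity q) → Term C p l k) : Term C p l k
  | unique {k : ℕ} (g : Bound) (c : Cond C p l (k + 1)) : Term C p l k

/-- Conditions: atomic formulas, bounded existential quantification `exists z ≤ g(n)`, relational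
queries to supplementary instances, Boolean combinations. -/
inductive Cond (C : Ctx.{u}) (p l : ℕ) : ℕ → Type u
  | tt {k : ℕ} : Cond C p l k
  | eq {k : ℕ} (s t : Term C p l k) : Cond C p l k
  | le {k : ℕ} (s t : Term C p l k) : Cond C p l k
  | aux {k : ℕ} (R : C.aux.Rel) (ts : Fin (C.aux.relArity R) → Term C p l k) : Cond C p l k
  | tmp {k : ℕ} (R : C.tmp.Rel) (ts : Fin (C.tmp.relArity R) → Term C p l k) : Cond C p l k
  | query {k : ℕ} (i : C.Inst) (q : (C.sig i).RelQuery)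
      (ts : Fin ((C.sig i).relArity q) → Term C p l k) : Cond C p l k
  | not {k : ℕ} (c : Cond C p l k) : Cond C p l k
  | and {k : ℕ} (c d : Cond C p l k) : Cond C p l k
  | or {k : ℕ} (c d : Cond C p l k) : Cond C p l k
  | ex {k : ℕ} (g : Bound) (c : Cond C p l (k + 1)) : Cond C p l k

end

/-! ## Syntax of procedures -/

/-- Series of instructions in the scope of `k` parallel branches. An assignment in the scope of
parallel branches has to have each of the variables bound by them among its arguments. -/
inductive Stmt (C : Ctx.{u}) (p l : ℕ) : ℕ → Type u
  | skip {k : ℕ} : Stmt C p l k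
  | assignFun {k : ℕ} (f : C.tmp.Fun) (ts : Fin (C.tmp.funArity f) → Term C p l k)
      (h : ∀ z : Fin k, ∃ i, ts i = Term.loc z) (t : Term C p l k) : Stmt C p l k
  | assignRel {k : ℕ} (R : C.tmp.Rel) (ts : Fin (C.tmp.relArity R) → Term C p l k)
      (h : ∀ z : Fin k, ∃ i, ts i = Term.loc z) (c : Cond C p l k) : Stmt C p l k
  | seq {k : ℕ} (s t : Stmt C p l k) : Stmt C p l k
  | ite {k : ℕ} (c : Cond C p l k) (s t : Stmt C p l k) : Stmt C p l k
  | par {k : ℕ} (g : Bound) (s : Stmt C p l (k + 1)) : Stmt C p l k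

/-- Initial procedures: no index variables; change operations of supplementary instances can be
invoked, but not in the scope of parallel branches. -/
inductive InitProc (C : Ctx.{u}) (p : ℕ) : Type u
  | stmt (s : Stmt C p 0 0) : InitProc C p
  | seq (P Q : InitProc C p) : InitProc C p
  | ite (c : Cond C p 0 0) (P Q : InitProc C p) : InitProc C p
  | change (i : C.Inst) (c : (C.sig i).Change)
      (ts : Fin ((C.sig i).changeArity c) → Term C p 0 0) : InitProc C p

/-- The procedure contains a change invocation for the supplementary instance `i`. -/
def InitProc.Invokes {C : Ctx.{u}} {p : ℕ} (i : C.Inst) : InitProc C p → Prop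
  | .stmt _ => False
  | .seq P Q => P.Invokes i ∨ Q.Invokes i
  | .ite _ P Q => P.Invokes i ∨ Q.Invokes i
  | .change j _ _ => j = i

/-- Main procedures: every execution path ends with a return statement, and there are no return
statements inside parallel branches. The returned expressions are of type `E`
(terms or conditions). -/
inductive MainProc (C : Ctx.{u}) (p l : ℕ) (E : Type u) : Type u
  | ret (e : E) : MainProc C p l E
  | seq (s : Stmt C p l 0) (P : MainProc C p l E) : MainProc C p l E
  | ite (c : Cond C p l 0) (P Q : MainProc C p l E) : MainProc C p l E

/-- The rule for the update of an auxiliary symbol of arity `a`: after the initial procedure, for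
every tuple `x̄` with `x_j ≤ bound j (n)` for all `j`, the new value at the position
`target (x̄)` is the one returned by the main procedure. The returned expressions are of type
`E l` where `l` is the length of `x̄`. -/
structure UpdateRule (C : Ctx.{u}) (p a : ℕ) (E : ℕ → Type u) where
  initial : InitProc C p
  numIndex : ℕ
  bound : Fin numIndex → Bound
  target : Fin a → Term C.auxOnly p numIndex 0
  main : MainProc C p numIndex (E numIndex)

/-- The rules of a dynamic program, apart from those of its supplementary instances. -/
structure Rules (C : Ctx.{u}) (S : OpSig.{u}) where
  /-- First-order initialization of the auxiliary relations. As the input structure is empty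
  initially, only `≤`, `+` and `×` can be used. -/
  relInit : (R : C.aux.Rel) → arith.Formula (Fin (C.aux.relArity R))
  /-- First-order initialization of the auxiliary functions, by a formula for the graph; the last
  variable is for the function value. -/
  funInit : (f : C.aux.Fun) → arith.Formula (Fin (C.aux.funArity f + 1))
  relRule : (c : S.Change) → (R : C.aux.Rel) →
    UpdateRule C (S.changeArity c) (C.aux.relArity R) (fun l => Cond C (S.changeArity c) l 0)
  funRule : (c : S.Change) → (f : C.aux.Fun) →
    UpdateRule C (S.changeArity c) (C.aux.funArity f) (fun l => Term C (S.changeArity c) l 0)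
  relQueryRule : (q : S.RelQuery) → MainProc C (S.relArity q) 0 (Cond C (S.relArity q) 0 0)
  funQueryRule : (q : S.FunQuery) → MainProc C (S.funArity q) 0 (Term C (S.funArity q) 0 0)

/-- The initial procedure of the update rule for an auxiliary symbol. -/
def Rules.initial {C : Ctx.{u}} {S : OpSig.{u}} (B : Rules C S) (c : S.Change) :
    C.aux.Rel ⊕ C.aux.Fun → InitProc C (S.changeArity c)
  | .inl R => (B.relRule c R).initial
  | .inr f => (B.funRule c f).initial

/-- For each change operation and each supplementary instance, at most one update rule invokes
change operations for that instance. -/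
def Rules.SingleInvocation {C : Ctx.{u}} {S : OpSig.{u}} (B : Rules C S) : Prop :=
  ∀ (c : S.Change) (i : C.Inst) (s t : C.aux.Rel ⊕ C.aux.Fun),
    (B.initial c s).Invokes i → (B.initial c t).Invokes i → s = t

/-- Procedural dynamic first-order programs: finitely many supplementary instances, each with a
dynamic program of its own, and rules that can use them. -/
inductive Program : OpSig.{u} → Type (u + 1)
  | mk {S : OpSig.{u}} (C : Ctx.{u}) (inst : (i : C.Inst) → Program (C.sig i))
      (rules : Rules C S) (single : rules.SingleInvocation) : Program S

/-! ## Semantics and work of terms and conditions -/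

/-- The values of a store: a structure over the schema of the assigned symbols, and the information
which of its positions have been assigned. -/
structure Store (σ : Schema) (n : ℕ) extends Str σ n where
  relWritten : (R : σ.Rel) → (Fin (σ.relArity R) → Fin n) → Prop
  funWritten : (f : σ.Fun) → (Fin (σ.funArity f) → Fin n) → Prop

/-- The store in which nothing has been assigned: symbols that are used without a previous assignment
have the value `⊥` or false. -/
def Store.blank (σ : Schema) (n : ℕ) : Store σ n where
  rel := fun _ _ => False
  fn := fun _ _ => none
  relWritten := fun _ _ => False
  funWritten := fun _ _ => False

/-- The same values, but nothing marked as assigned. -/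
def Store.unmark {σ : Schema} {n : ℕ} (s : Store σ n) : Store σ n :=
  { s with
    relWritten := fun _ _ => False
    funWritten := fun _ _ => False }

/-- What the instructions of a procedure refer to. -/
structure Memory (C : Ctx.{u}) (n : ℕ) (M : (i : C.Inst) → Execution (C.sig i) n) where
  aux : Str C.aux n
  store : Store C.tmp n
  inst : (i : C.Inst) → (M i).State

/-- A tuple of defined values. -/
def Defined {n a : ℕ} (o : Fin a → Option (Fin n)) (x : Fin a → Fin n) : Prop :=
  ∀ j, o j = some (x j)

open Classical in
/-- Application of a partial function to possibly undefined arguments. -/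
noncomputable def applyFun {n a : ℕ} (F : (Fin a → Fin n) → Option (Fin n))
    (o : Fin a → Option (Fin n)) : Option (Fin n) :=
  if h : ∃ x, Defined o x then F h.choose else none

/-- A partial binary operation on `[n]`: undefined if the result is not in the domain. -/
def arithOp (n : ℕ) (op : ℕ → ℕ → ℕ) : Option (Fin n) → Option (Fin n) → Option (Fin n)
  | some a, some b => if h : op a b < n then some ⟨op a b, h⟩ else none
  | _, _ => none

section Semantics

variable {C : Ctx.{u}} {n : ℕ} {M : (i : C.Inst) → Execution (C.sig i) n} {p l : ℕ}

mutual

/-- The value of a term. -/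
noncomputable def Term.eval (m : Memory C n M) (x : Fin p → Fin n) (y : Fin l → Fin n) :
    {k : ℕ} → Term C p l k → (Fin k → Fin n) → Option (Fin n)
  | _, .undef, _ => none
  | _, .param i, _ => some (x i)
  | _, .index i, _ => some (y i)
  | _, .loc i, z => some (z i)
  | _, .add s t, z => arithOp n (· + ·) (s.eval m x y z) (t.eval m x y z)
  | _, .mul s t, z => arithOp n (· * ·) (s.eval m x y z) (t.eval m x y z)
  | _, .aux f ts, z => applyFun (m.aux.fn f) (fun j => (ts j).eval m x y z)
  | _, .tmp f ts, z => applyFun (m.store.fn f) (fun j => (ts j).eval m x y z)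
  | _, .ite c s t, z =>
      open Classical in if c.eval m x y z then s.eval m x y z else t.eval m x y z
  | _, .query i q ts, z =>
      applyFun (fun a => (M i).funQuery q a (m.inst i)) (fun j => (ts j).eval m x y z)
  | _, .unique g c, z =>
      open Classical in
      if h : ∃! a : Fin n, (a : ℕ) ≤ g.1 n ∧ c.eval m x y (Fin.snoc z a) then some h.choose
      else none

/-- The truth value of a condition. Atomic formulas with an undefined argument are false. -/
noncomputable def Cond.eval (m : Memory C n M) (x : Fin p → Fin n) (y : Fin l → Fin n) :
    {k : ℕ} → Cond C p l k → (Fin k → Fin n) → Prop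
  | _, .tt, _ => True
  | _, .eq s t, z => ∃ a, s.eval m x y z = some a ∧ t.eval m x y z = some a
  | _, .le s t, z => ∃ a b, s.eval m x y z = some a ∧ t.eval m x y z = some b ∧ a ≤ b
  | _, .aux R ts, z => ∃ a, Defined (fun j => (ts j).eval m x y z) a ∧ m.aux.rel R a
  | _, .tmp R ts, z => ∃ a, Defined (fun j => (ts j).eval m x y z) a ∧ m.store.rel R a
  | _, .query i q ts, z =>
      ∃ a, Defined (fun j => (ts j).eval m x y z) a ∧ (M i).relQuery q a (m.inst i)
  | _, .not c, z => ¬ c.eval m x y z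
  | _, .and c d, z => c.eval m x y z ∧ d.eval m x y z
  | _, .or c d, z => c.eval m x y z ∨ d.eval m x y z
  | _, .ex g c, z => ∃ a : Fin n, (a : ℕ) ≤ g.1 n ∧ c.eval m x y (Fin.snoc z a)

end

mutual

/-- The evaluation of the term meets all requirements: for every expression `unique z ≤ g(n)` that
is evaluated, there is exactly one witness. -/
def Term.Ok (m : Memory C n M) (x : Fin p → Fin n) (y : Fin l → Fin n) :
    {k : ℕ} → Term C p l k → (Fin k → Fin n) → Prop
  | _, .undef, _ => True
  | _, .param _, _ => True
  | _, .index _, _ => True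
  | _, .loc _, _ => True
  | _, .add s t, z => s.Ok m x y z ∧ t.Ok m x y z
  | _, .mul s t, z => s.Ok m x y z ∧ t.Ok m x y z
  | _, .aux _ ts, z => ∀ j, (ts j).Ok m x y z
  | _, .tmp _ ts, z => ∀ j, (ts j).Ok m x y z
  | _, .ite c s t, z =>
      c.Ok m x y z ∧ (c.eval m x y z → s.Ok m x y z) ∧ (¬ c.eval m x y z → t.Ok m x y z)
  | _, .query i q ts, z => (∀ j, (ts j).Ok m x y z) ∧
      ∀ a, Defined (fun j => (ts j).eval m x y z) a → (M i).funQueryOk q a (m.inst i)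
  | _, .unique g c, z =>
      (∃! a : Fin n, (a : ℕ) ≤ g.1 n ∧ c.eval m x y (Fin.snoc z a)) ∧
        ∀ a : Fin n, (a : ℕ) ≤ g.1 n → c.Ok m x y (Fin.snoc z a)

/-- The evaluation of the condition meets all requirements. -/
def Cond.Ok (m : Memory C n M) (x : Fin p → Fin n) (y : Fin l → Fin n) :
    {k : ℕ} → Cond C p l k → (Fin k → Fin n) → Prop
  | _, .tt, _ => True
  | _, .eq s t, z => s.Ok m x y z ∧ t.Ok m x y z
  | _, .le s t, z => s.Ok m x y z ∧ t.Ok m x y z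
  | _, .aux _ ts, z => ∀ j, (ts j).Ok m x y z
  | _, .tmp _ ts, z => ∀ j, (ts j).Ok m x y z
  | _, .query i q ts, z => (∀ j, (ts j).Ok m x y z) ∧
      ∀ a, Defined (fun j => (ts j).eval m x y z) a → (M i).relQueryOk q a (m.inst i)
  | _, .not c, z => c.Ok m x y z
  | _, .and c d, z => c.Ok m x y z ∧ d.Ok m x y z
  | _, .or c d, z => c.Ok m x y z ∧ d.Ok m x y z
  | _, .ex g c, z => ∀ a : Fin n, (a : ℕ) ≤ g.1 n → c.Ok m x y (Fin.snoc z a)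

end

/-- The maximum of finitely many numbers and `1`. -/
def maxWork {a : ℕ} (w : Fin a → ℕ) : ℕ := max 1 (Finset.univ.sup w)

mutual

/-- The work of a term. A range `z ≤ g(n)` contributes the factor `g(n) + 1`, the number of its
elements `0, …, g(n)`. -/
def Term.work (M : (i : C.Inst) → Execution (C.sig i) n) : {k : ℕ} → Term C p l k → ℕ
  | _, .undef => 1
  | _, .param _ => 1
  | _, .index _ => 1
  | _, .loc _ => 1
  | _, .add s t => max (s.work M) (t.work M)
  | _, .mul s t => max (s.work M) (t.work M)
  | _, .aux _ ts => maxWork (fun j => (ts j).work M)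
  | _, .tmp _ ts => maxWork (fun j => (ts j).work M)
  | _, .ite c s t => max (c.work M) (max (s.work M) (t.work M))
  | _, .query i q ts => max ((M i).funQueryWork q) (maxWork (fun j => (ts j).work M))
  | _, .unique g c => (g.1 n + 1) * c.work M

/-- The work of a condition. -/
def Cond.work (M : (i : C.Inst) → Execution (C.sig i) n) : {k : ℕ} → Cond C p l k → ℕ
  | _, .tt => 1
  | _, .eq s t => max (s.work M) (t.work M)
  | _, .le s t => max (s.work M) (t.work M)
  | _, .aux _ ts => maxWork (fun j => (ts j).work M)
  | _, .tmp _ ts => maxWork (fun j => (ts j).work M)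
  | _, .query i q ts => max ((M i).relQueryWork q) (maxWork (fun j => (ts j).work M))
  | _, .not c => c.work M
  | _, .and c d => max (c.work M) (d.work M)
  | _, .or c d => max (c.work M) (d.work M)
  | _, .ex g c => (g.1 n + 1) * c.work M

end

/-! ## Semantics and work of procedures -/

/-- The store after a series of instructions. An assignment with an undefined argument on its
left-hand side has no effect. The branches of a parallel branching are executed independently of
each other, and then all their assignments take effect. -/
noncomputable def Stmt.exec (x : Fin p → Fin n) (y : Fin l → Fin n) :
    {k : ℕ} → Stmt C p l k → (Fin k → Fin n) → Memory C n M → Store C.tmp n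
  | _, .skip, _, m => m.store
  | _, .assignFun f ts _ t, z, m =>
      open Classical in
      { m.store with
        fn := Function.update m.store.fn f fun a =>
          if Defined (fun j => (ts j).eval m x y z) a then t.eval m x y z else m.store.fn f a
        funWritten := Function.update m.store.funWritten f fun a =>
          Defined (fun j => (ts j).eval m x y z) a ∨ m.store.funWritten f a }
  | _, .assignRel R ts _ c, z, m =>
      open Classical in
      { m.store with
        rel := Function.update m.store.rel R fun a =>
          if Defined (fun j => (ts j).eval m x y z) a then c.eval m x y z else m.store.rel R a
        relWritten := Function.update m.store.relWritten R fun a =>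
          Defined (fun j => (ts j).eval m x y z) a ∨ m.store.relWritten R a }
  | _, .seq s t, z, m => t.exec x y z { m with store := s.exec x y z m }
  | _, .ite c s t, z, m =>
      open Classical in if c.eval m x y z then s.exec x y z m else t.exec x y z m
  | _, .par g s, z, m =>
      open Classical in
      let branch : Fin n → Store C.tmp n := fun b =>
        s.exec x y (Fin.snoc z b) { m with store := m.store.unmark }
      { rel := fun R a =>
          if h : ∃ b : Fin n, (b : ℕ) ≤ g.1 n ∧ (branch b).relWritten R a
          then (branch h.choose).rel R a else m.store.rel R a
        fn := fun f a =>
          if h : ∃ b : Fin n, (b : ℕ) ≤ g.1 n ∧ (branch b).funWritten f a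
          then (branch h.choose).fn f a else m.store.fn f a
        relWritten := fun R a => m.store.relWritten R a ∨
          ∃ b : Fin n, (b : ℕ) ≤ g.1 n ∧ (branch b).relWritten R a
        funWritten := fun f a => m.store.funWritten f a ∨
          ∃ b : Fin n, (b : ℕ) ≤ g.1 n ∧ (branch b).funWritten f a }

/-- The execution meets all requirements; in particular, if parallel branches assign a value to the
same position, then they assign the same value. -/
def Stmt.Ok (x : Fin p → Fin n) (y : Fin l → Fin n) :
    {k : ℕ} → Stmt C p l k → (Fin k → Fin n) → Memory C n M → Prop
  | _, .skip, _, _ => True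
  | _, .assignFun _ ts _ t, z, m => (∀ j, (ts j).Ok m x y z) ∧ t.Ok m x y z
  | _, .assignRel _ ts _ c, z, m => (∀ j, (ts j).Ok m x y z) ∧ c.Ok m x y z
  | _, .seq s t, z, m => s.Ok x y z m ∧ t.Ok x y z { m with store := s.exec x y z m }
  | _, .ite c s t, z, m =>
      c.Ok m x y z ∧ (c.eval m x y z → s.Ok x y z m) ∧ (¬ c.eval m x y z → t.Ok x y z m)
  | _, .par g s, z, m =>
      let m' : Memory C n M := { m with store := m.store.unmark }
      let branch : Fin n → Store C.tmp n := fun b => s.exec x y (Fin.snoc z b) m'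
      (∀ b : Fin n, (b : ℕ) ≤ g.1 n → s.Ok x y (Fin.snoc z b) m') ∧
        ∀ b b' : Fin n, (b : ℕ) ≤ g.1 n → (b' : ℕ) ≤ g.1 n →
          (∀ R a, (branch b).relWritten R a → (branch b').relWritten R a →
            ((branch b).rel R a ↔ (branch b').rel R a)) ∧
          (∀ f a, (branch b).funWritten f a → (branch b').funWritten f a →
            (branch b).fn f a = (branch b').fn f a)

/-- The work of a series of instructions. -/
def Stmt.work (M : (i : C.Inst) → Execution (C.sig i) n) : {k : ℕ} → Stmt C p l k → ℕ
  | _, .skip => 1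
  | _, .assignFun _ ts _ t => max (maxWork (fun j => (ts j).work M)) (t.work M)
  | _, .assignRel _ ts _ c => max (maxWork (fun j => (ts j).work M)) (c.work M)
  | _, .seq s t => max (s.work M) (t.work M)
  | _, .ite c s t => max (c.work M) (max (s.work M) (t.work M))
  | _, .par g s => (g.1 n + 1) * s.work M

/-- The memory after an initial procedure. A change invocation with an undefined argument has no
effect. -/
noncomputable def InitProc.exec (x : Fin p → Fin n) : InitProc C p → Memory C n M → Memory C n M
  | .stmt s, m => { m with store := s.exec x Fin.elim0 Fin.elim0 m }
  | .seq P Q, m => Q.exec x (P.exec x m)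
  | .ite c P Q, m =>
      open Classical in
      if c.eval m x Fin.elim0 Fin.elim0 then P.exec x m else Q.exec x m
  | .change i c ts, m =>
      open Classical in
      if h : ∃ a, Defined (fun j => (ts j).eval m x Fin.elim0 Fin.elim0) a then
        { m with inst := Function.update m.inst i ((M i).change c h.choose (m.inst i)) }
      else m

/-- The execution of the initial procedure meets all requirements. -/
def InitProc.Ok (x : Fin p → Fin n) : InitProc C p → Memory C n M → Prop
  | .stmt s, m => s.Ok x Fin.elim0 Fin.elim0 m
  | .seq P Q, m => P.Ok x m ∧ Q.Ok x (P.exec x m)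
  | .ite c P Q, m => c.Ok m x Fin.elim0 Fin.elim0 ∧
      (c.eval m x Fin.elim0 Fin.elim0 → P.Ok x m) ∧ (¬ c.eval m x Fin.elim0 Fin.elim0 → Q.Ok x m)
  | .change i c ts, m => (∀ j, (ts j).Ok m x Fin.elim0 Fin.elim0) ∧
      ∀ a, Defined (fun j => (ts j).eval m x Fin.elim0 Fin.elim0) a →
        (M i).changeOk c a (m.inst i)

/-- The work of an initial procedure. -/
def InitProc.work (M : (i : C.Inst) → Execution (C.sig i) n) : InitProc C p → ℕ
  | .stmt s => s.work M
  | .seq P Q => max (P.work M) (Q.work M)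
  | .ite c P Q => max (c.work M) (max (P.work M) (Q.work M))
  | .change i c ts => max ((M i).changeWork c) (maxWork (fun j => (ts j).work M))

/-- The returned expression, together with the memory in which it has to be evaluated. -/
noncomputable def MainProc.exec {E : Type u} (x : Fin p → Fin n) (y : Fin l → Fin n) :
    MainProc C p l E → Memory C n M → E × Memory C n M
  | .ret e, m => (e, m)
  | .seq s P, m => P.exec x y { m with store := s.exec x y Fin.elim0 m }
  | .ite c P Q, m =>
      open Classical in if c.eval m x y Fin.elim0 then P.exec x y m else Q.exec x y m

/-- The execution of the main procedure up to its return statement meets all requirements. -/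
def MainProc.Ok {E : Type u} (x : Fin p → Fin n) (y : Fin l → Fin n) :
    MainProc C p l E → Memory C n M → Prop
  | .ret _, _ => True
  | .seq s P, m =>
      s.Ok x y Fin.elim0 m ∧ P.Ok x y { m with store := s.exec x y Fin.elim0 m }
  | .ite c P Q, m => c.Ok m x y Fin.elim0 ∧
      (c.eval m x y Fin.elim0 → P.Ok x y m) ∧ (¬ c.eval m x y Fin.elim0 → Q.Ok x y m)

/-- The work of a main procedure, for a given work of the returned expressions. -/
def MainProc.work {E : Type u} (M : (i : C.Inst) → Execution (C.sig i) n) (w : E → ℕ) :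
    MainProc C p l E → ℕ
  | .ret e => w e
  | .seq s P => max (s.work M) (P.work M w)
  | .ite c P Q => max (c.work M) (max (P.work M w) (Q.work M w))

/-- The truth value returned by a main procedure. -/
noncomputable def MainProc.evalRel (P : MainProc C p l (Cond C p l 0)) (x : Fin p → Fin n)
    (y : Fin l → Fin n) (m : Memory C n M) : Prop :=
  (P.exec x y m).1.eval (P.exec x y m).2 x y Fin.elim0

/-- The value returned by a main procedure. -/
noncomputable def MainProc.evalFun (P : MainProc C p l (Term C p l 0)) (x : Fin p → Fin n)
    (y : Fin l → Fin n) (m : Memory C n M) : Option (Fin n) :=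
  (P.exec x y m).1.eval (P.exec x y m).2 x y Fin.elim0

/-- The execution, including the evaluation of the returned condition, meets all requirements. -/
def MainProc.OkRel (P : MainProc C p l (Cond C p l 0)) (x : Fin p → Fin n)
    (y : Fin l → Fin n) (m : Memory C n M) : Prop :=
  P.Ok x y m ∧ (P.exec x y m).1.Ok (P.exec x y m).2 x y Fin.elim0

/-- The execution, including the evaluation of the returned term, meets all requirements. -/
def MainProc.OkFun (P : MainProc C p l (Term C p l 0)) (x : Fin p → Fin n)
    (y : Fin l → Fin n) (m : Memory C n M) : Prop :=
  P.Ok x y m ∧ (P.exec x y m).1.Ok (P.exec x y m).2 x y Fin.elim0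

/-! ## Semantics and work of update rules -/

/-- The memory for terms over the auxiliary schema only. -/
def auxMemory (A : Str C.aux n) : Memory C.auxOnly n (fun i => i.elim) where
  aux := A
  store := Store.blank _ n
  inst := fun i => i.elim

variable {a : ℕ} {E : ℕ → Type u}

/-- The tuple `y` satisfies the constraint of the update rule. -/
def UpdateRule.InRange (r : UpdateRule C p a E) (y : Fin r.numIndex → Fin n) : Prop :=
  ∀ j, (y j : ℕ) ≤ (r.bound j).1 n

/-- The tuple `y` satisfies the constraint, and the position that is updated for it is `t`. -/
def UpdateRule.Updates (r : UpdateRule C p a E) (A : Str C.aux n) (x : Fin p → Fin n)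
    (y : Fin r.numIndex → Fin n) (t : Fin a → Fin n) : Prop :=
  r.InRange y ∧ Defined (fun j => (r.target j).eval (auxMemory A) x y Fin.elim0) t

/-- The updated relation: among the positions that are updated, exactly those belong to it for
which the main procedure returns true. -/
noncomputable def UpdateRule.newRel (r : UpdateRule C p a (fun l => Cond C p l 0))
    (old : (Fin a → Fin n) → Prop) (m : Memory C n M) (x : Fin p → Fin n)
    (t : Fin a → Fin n) : Prop :=
  (old t ∧ ¬ ∃ y, r.Updates m.aux x y t) ∨
    ∃ y, r.Updates m.aux x y t ∧ r.main.evalRel x y (r.initial.exec x m)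

open Classical in
/-- The updated function. -/
noncomputable def UpdateRule.newFun (r : UpdateRule C p a (fun l => Term C p l 0))
    (old : (Fin a → Fin n) → Option (Fin n)) (m : Memory C n M) (x : Fin p → Fin n)
    (t : Fin a → Fin n) : Option (Fin n) :=
  if h : ∃ y, r.Updates m.aux x y t then r.main.evalFun x h.choose (r.initial.exec x m)
  else old t

/-- All executions for a rule that updates a relation meet all requirements. -/
def UpdateRule.OkRel (r : UpdateRule C p a (fun l => Cond C p l 0)) (m : Memory C n M)
    (x : Fin p → Fin n) : Prop :=
  r.initial.Ok x m ∧ ∀ y, r.InRange y →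
    (∀ j, (r.target j).Ok (auxMemory m.aux) x y Fin.elim0) ∧
      r.main.OkRel x y (r.initial.exec x m)

/-- All executions for a rule that updates a function meet all requirements; in particular, the new
value is uniquely determined. -/
def UpdateRule.OkFun (r : UpdateRule C p a (fun l => Term C p l 0)) (m : Memory C n M)
    (x : Fin p → Fin n) : Prop :=
  (r.initial.Ok x m ∧ ∀ y, r.InRange y →
    (∀ j, (r.target j).Ok (auxMemory m.aux) x y Fin.elim0) ∧
      r.main.OkFun x y (r.initial.exec x m)) ∧
  ∀ t y y', r.Updates m.aux x y t → r.Updates m.aux x y' t →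
    r.main.evalFun x y (r.initial.exec x m) = r.main.evalFun x y' (r.initial.exec x m)

/-- The work of an update rule: the initial procedure once, and for each tuple of the range the
main procedure and the computation of the position that is updated. -/
def UpdateRule.work (M : (i : C.Inst) → Execution (C.sig i) n) (r : UpdateRule C p a E)
    (w : E r.numIndex → ℕ) : ℕ :=
  max (r.initial.work M)
    ((∏ j, ((r.bound j).1 n + 1)) *
      max (r.main.work M w)
        (maxWork fun j => (r.target j).work (n := n) (fun i : Empty => i.elim)))

end Semantics

/-! ## Semantics and work of dynamic programs -/

section Programs

variable {C : Ctx.{u}} {S : OpSig.{u}} {n : ℕ}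

/-- The memory at the beginning of every procedure. -/
def startMemory (M : (i : C.Inst) → Execution (C.sig i) n)
    (s : Str C.aux n × ((i : C.Inst) → (M i).State)) : Memory C n M where
  aux := s.1
  store := Store.blank _ n
  inst := s.2

open Classical in
/-- The auxiliary structure at the beginning. -/
noncomputable def Rules.initStr (B : Rules C S) (n : ℕ) : Str C.aux n where
  rel := fun R a => (B.relInit R).Realize a
  fn := fun f a =>
    if h : ∃! b : Fin n, (B.funInit f).Realize (Fin.snoc a b : Fin _ → Fin n) then some h.choose
    else none

open Classical in
/-- The execution of a dynamic program on the domain `[n]`, given those of its supplementary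
instances. All update rules are evaluated on the old state. A supplementary instance is changed
only by the update rule that invokes change operations for it, if there is one. -/
noncomputable def Rules.execution (B : Rules C S) (M : (i : C.Inst) → Execution (C.sig i) n) :
    Execution S n where
  State := Str C.aux n × ((i : C.Inst) → (M i).State)
  init := (B.initStr n, fun i => (M i).init)
  change := fun c x s =>
    let m := startMemory M s
    ({ rel := fun R => (B.relRule c R).newRel (s.1.rel R) m x
       fn := fun f => (B.funRule c f).newFun (s.1.fn f) m x },
     fun i =>
      if h : ∃ σ, (B.initial c σ).Invokes i then ((B.initial c h.choose).exec x m).inst i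
      else s.2 i)
  relQuery := fun q x s => (B.relQueryRule q).evalRel x Fin.elim0 (startMemory M s)
  funQuery := fun q x s => (B.funQueryRule q).evalFun x Fin.elim0 (startMemory M s)
  changeOk := fun c x s =>
    (∀ R, (B.relRule c R).OkRel (startMemory M s) x) ∧
      ∀ f, (B.funRule c f).OkFun (startMemory M s) x
  relQueryOk := fun q x s => (B.relQueryRule q).OkRel x Fin.elim0 (startMemory M s)
  funQueryOk := fun q x s => (B.funQueryRule q).OkFun x Fin.elim0 (startMemory M s)
  changeWork := fun c =>
    max (Finset.univ.sup fun R => (B.relRule c R).work M (Cond.work M))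
      (Finset.univ.sup fun f => (B.funRule c f).work M (Term.work M))
  relQueryWork := fun q => (B.relQueryRule q).work M (Cond.work M)
  funQueryWork := fun q => (B.funQueryRule q).work M (Term.work M)

end Programs

/-- The execution of a dynamic program on the domain `[n]`. -/
noncomputable def Program.execution : {S : OpSig.{u}} → Program S → (n : ℕ) → Execution S n
  | _, .mk _ inst rules _, n => rules.execution (fun i => (inst i).execution n)

/-- `P` is a dynamic program for the dynamic problem `Q`: on every domain and after every sequence
of change operations, all operations can be executed, and all queries yield the correct result. -/
def Program.IsProgramFor {S : OpSig.{u}} (P : Program S) (Q : DynProblem.{u, v} S) : Prop :=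
  ∀ (n : ℕ) (ops : List ((c : S.Change) × (Fin (S.changeArity c) → Fin n))),
    (∀ c x, (P.execution n).changeOk c x ((P.execution n).run ops)) ∧
    (∀ q x, (P.execution n).relQueryOk q x ((P.execution n).run ops) ∧
      ((P.execution n).relQuery q x ((P.execution n).run ops) ↔
        (Q n).relQuery q x ((Q n).run ops))) ∧
    (∀ q x, (P.execution n).funQueryOk q x ((P.execution n).run ops) ∧
      (P.execution n).funQuery q x ((P.execution n).run ops) =
        (Q n).funQuery q x ((Q n).run ops))

/-- The work of each change and query operation of `P` is in `O(f(n))`. -/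
def Program.HasWork {S : OpSig.{u}} (P : Program S) (f : ℕ → ℝ) : Prop :=
  (∀ c, (fun n => ((P.execution n).changeWork c : ℝ)) =O[Filter.atTop] f) ∧
  (∀ q, (fun n => ((P.execution n).relQueryWork q : ℝ)) =O[Filter.atTop] f) ∧
  (∀ q, (fun n => ((P.execution n).funQueryWork q : ℝ)) =O[Filter.atTop] f)

/-- The dynamic problem `Q` can be maintained in DynFO with work `O(f(n))` per query and change
operation. -/
def MaintainableWithWork {S : OpSig.{u}} (Q : DynProblem.{u, v} S) (f : ℕ → ℝ) : Prop :=
  ∃ P : Program S, P.IsProgramFor Q ∧ P.HasWork f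

/-! ## The dynamic range membership problem of a language -/

/-- The change operations on words: `set_σ(i)` and `reset(i)`. -/
inductive WordChange (α : Type u) : Type u
  | set (σ : α) : WordChange α
  | reset : WordChange α

instance {α : Type u} [Finite α] : Finite (WordChange α) :=
  Finite.of_injective
    (fun c : WordChange α => (match c with | .set σ => some σ | .reset => none : Option α))
    (by rintro (_ | _) (_ | _) h <;> simp_all)

/-- The operations of `RangeMember`: the changes `set_σ(i)` and `reset(i)`, and the query
`range(ℓ, r)`. -/
def rangeMemberSig (α : Type u) [Finite α] : OpSig.{u} where
  Change := WordChange α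
  changeArity := fun _ => 1
  RelQuery := PUnit
  relArity := fun _ => 2
  FunQuery := PEmpty
  funArity := fun q => q.elim

/-- The word `w_ℓ ∘ ⋯ ∘ w_r`; positions without a letter (`none`) contribute the empty word. -/
def subword {α : Type u} {n : ℕ} (w : Fin n → Option α) (l r : Fin n) : List α :=
  ((List.finRange n).filter fun i => l ≤ i ∧ i ≤ r).filterMap w

/-- The dynamic problem `RangeMember(L)`: `set_σ(i)` sets `w_i` to `σ` if there is no letter at
position `i` (and has no effect otherwise), `reset(i)` deletes the letter at position `i`. -/
def rangeMember {α : Type u} [Finite α] (L : Language α) :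
    DynProblem.{u, u} (rangeMemberSig α) := fun n =>
  { State := Fin n → Option α
    init := fun _ => none
    change := fun c (x : Fin 1 → Fin n) w =>
      match c with
      | .set σ => Function.update w (x 0) ((w (x 0)).or (some σ))
      | .reset => Function.update w (x 0) none
    relQuery := fun _ (x : Fin 2 → Fin n) w => subword w (x 0) (x 1) ∈ L
    funQuery := fun q _ _ => q.elim }

end DynFO

-- Fix a DFA for `L` and a constant `d` with `2 / ε ≤ d + 1`, and let `B = fanout d n` exceed by one
-- the largest `z` with `z ^ (d + 1) < n`, so that `B ^ (d + 1) ≥ n` and `B` is of order `n ^ (1 /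
-- (d + 1))`. Cut the positions into blocks of `B ^ j` positions for each level `j`: a block of
-- level `j + 1` consists of `B` blocks of level `j`, and a single block of level `d + 1` covers the
-- whole domain. For each level `j ≤ d`, the transitions of the automaton are stored for every run
-- of consecutive level-`j` blocks inside one block of level `j + 1`, as long as both ends of the
-- run are elements of the domain.
--
-- A query climbs through the levels. If both ends lie in the same block of the next level, one
-- stored run suffices; otherwise a run at each end is split off and the rest is aligned to the next
-- level (`Invariant.reads_rangeC`). This uses at most two runs per level, and composing transitions
-- is a finite disjunction over states, so the work is constant.
--
-- A change at position `c` affects, at level `j`, only runs in the level-`(j + 1)` block of `c`.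
-- Two block numbers below `B` address such a run, whence work `B ^ 2`, which is `O(n ^ ε)`
-- (`exists_index`, `relRule_work_le`, `fanout_sq_isBigO`). The new run is the old run before the
-- level-`j` block of `c`, the new word of that block, and the old run after it (`reads_spliceC`).
-- As all rules see the old state, the new word of the block is itself recomputed by descending
-- through the levels (`reads_blockC`).
--
-- Neither `B` nor its powers need be elements of the domain. Block borders are therefore defined by
-- order and divisibility, and multiplication by `B` is expressed through `B - 1`.

namespace DynFO

/-! ## Predicates that are first-order definable uniformly in the domain size -/

/-- A family of predicates on valuations in `[n]` that one fixed formula defines for all `n`. -/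
def UniformlyDefinable {ι : Type} (P : ∀ n : ℕ, (ι → Fin n) → Prop) : Prop :=
  ∃ φ : arith.Formula ι, ∀ (n : ℕ) (v : ι → Fin n), φ.Realize v ↔ P n v

namespace UniformlyDefinable

variable {ι : Type} {P Q : ∀ n : ℕ, (ι → Fin n) → Prop}

theorem congr (hP : UniformlyDefinable P) (h : ∀ n v, P n v ↔ Q n v) : UniformlyDefinable Q := by
  obtain ⟨φ, hφ⟩ := hP
  exact ⟨φ, fun n v => (hφ n v).trans (h n v)⟩

theorem true : UniformlyDefinable (fun n (_ : ι → Fin n) => True) :=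
  ⟨⊤, fun n v => by simp⟩

theorem not (hP : UniformlyDefinable P) : UniformlyDefinable (fun n v => ¬ P n v) := by
  obtain ⟨φ, hφ⟩ := hP
  exact ⟨φ.not, fun n v => by rw [FirstOrder.Language.Formula.realize_not, hφ]⟩

theorem and (hP : UniformlyDefinable P) (hQ : UniformlyDefinable Q) :
    UniformlyDefinable (fun n v => P n v ∧ Q n v) := by
  obtain ⟨φ, hφ⟩ := hP
  obtain ⟨ψ, hψ⟩ := hQ
  exact ⟨φ ⊓ ψ, fun n v => by rw [FirstOrder.Language.Formula.realize_inf, hφ, hψ]⟩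

theorem imp (hP : UniformlyDefinable P) (hQ : UniformlyDefinable Q) :
    UniformlyDefinable (fun n v => P n v → Q n v) :=
  (hP.and hQ.not).not.congr fun n v => by tauto

/-- The quantified variable is adjoined to the free ones as `Sum.inr ()`, so nested quantifiers
appear as iterated sums of index types. -/
theorem ex {R : ∀ n : ℕ, (ι → Fin n) → Fin n → Prop}
    (hR : UniformlyDefinable (ι := ι ⊕ Unit) fun n v => R n (v ∘ Sum.inl) (v (Sum.inr ()))) :
    UniformlyDefinable (fun n v => ∃ z, R n v z) := by
  obtain ⟨φ, hφ⟩ := hR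
  refine ⟨φ.iExs Unit, fun n v => ?_⟩
  rw [FirstOrder.Language.Formula.realize_iExs]
  constructor
  · rintro ⟨i, hi⟩
    exact ⟨i (), by simpa using (hφ n _).1 hi⟩
  · rintro ⟨z, hz⟩
    exact ⟨fun _ => z, (hφ n _).2 (by simpa using hz)⟩

theorem all {R : ∀ n : ℕ, (ι → Fin n) → Fin n → Prop}
    (hR : UniformlyDefinable (ι := ι ⊕ Unit) fun n v => R n (v ∘ Sum.inl) (v (Sum.inr ()))) :
    UniformlyDefinable (fun n v => ∀ z, R n v z) :=
  (ex (R := fun n v z => ¬ R n v z) hR.not).not.congr fun n v => by simp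

theorem le (a b : ι) : UniformlyDefinable (fun n (v : ι → Fin n) => v a ≤ v b) :=
  ⟨(show arith.Relations 2 from ArithRel.le).formula₂ (.var a) (.var b), fun n v => by
    rw [FirstOrder.Language.Formula.realize_rel₂]; rfl⟩

theorem add (a b c : ι) :
    UniformlyDefinable (fun n (v : ι → Fin n) => (v a : ℕ) + v b = v c) :=
  ⟨(show arith.Relations 3 from ArithRel.add).formula ![.var a, .var b, .var c], fun n v => by
    rw [FirstOrder.Language.Formula.realize_rel]; rfl⟩

theorem mul (a b c : ι) :
    UniformlyDefinable (fun n (v : ι → Fin n) => (v a : ℕ) * v b = v c) :=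
  ⟨(show arith.Relations 3 from ArithRel.mul).formula ![.var a, .var b, .var c], fun n v => by
    rw [FirstOrder.Language.Formula.realize_rel]; rfl⟩

/-- Repeated multiplication, with each intermediate power quantified. This is sound because the
intermediate powers do not leave the domain when the last one is in it. -/
theorem pow (d : ℕ) {ι : Type} (a b : ι) :
    UniformlyDefinable (fun n (v : ι → Fin n) => (v a : ℕ) ^ (d + 1) = v b) := by
  induction d generalizing ι with
  | zero =>
    exact ((le a b).and (le b a)).congr fun n v => by
      simp only [Fin.le_def, zero_add, pow_one]; omega
  | succ d ih =>
    refine (ex (R := fun n v z => (v a : ℕ) ^ (d + 1) = z ∧ (z : ℕ) * v a = v b)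
      ((ih (Sum.inl a) (Sum.inr ())).and (mul (Sum.inr ()) (Sum.inl a) (Sum.inl b)))).congr
      fun n v => ⟨?_, fun h => ?_⟩
    · rintro ⟨z, h1, h2⟩
      rw [pow_succ, h1, h2]
    · refine ⟨⟨(v a : ℕ) ^ (d + 1), ?_⟩, rfl, (pow_succ _ _).symm.trans h⟩
      -- Powers increase with the exponent only for a positive base; for base `0` the power is `0`.
      rcases Nat.eq_zero_or_pos (v a : ℕ) with h0 | h0
      · rw [h0, zero_pow (by omega)]; exact (v a).pos
      · exact (Nat.pow_le_pow_right h0 (by omega)).trans_lt (h ▸ (v b).isLt)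

end UniformlyDefinable

/-! ## Roots, and blocks of positions -/

/-- The largest `z` with `z ^ (d + 1) < n`, for positive `n`. -/
def rootBelow (d n : ℕ) : ℕ := Nat.findGreatest (fun z => z ^ (d + 1) < n) n

/-- The search limit `n` loses nothing because `z ≤ z ^ (d + 1)`. The strict inequality says that
the power is an element of `[n]`, which is what makes the bound first-order definable. -/
theorem le_rootBelow_iff {d n z : ℕ} (hn : 0 < n) : z ≤ rootBelow d n ↔ z ^ (d + 1) < n := by
  have h0 : (rootBelow d n) ^ (d + 1) < n :=
    Nat.findGreatest_spec (P := fun z => z ^ (d + 1) < n) (Nat.zero_le n) (by simpa using hn)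
  refine ⟨fun h => (Nat.pow_le_pow_left h _).trans_lt h0, fun h => ?_⟩
  exact Nat.le_findGreatest ((Nat.le_self_pow (by omega) z).trans h.le) h

theorem rootBelow_lt {d n : ℕ} (hn : 0 < n) : rootBelow d n < n :=
  (Nat.le_self_pow (by omega) _).trans_lt ((le_rootBelow_iff (d := d) hn).1 le_rfl)

/-- The number of blocks of a level in a block of the next level. -/
def fanout (d n : ℕ) : ℕ := rootBelow d n + 1

theorem fanout_pos (d n : ℕ) : 0 < fanout d n := Nat.succ_pos _

/-- By maximality of the root, its successor violates the inequality. Hence one block of level `d +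
1` covers the domain. -/
theorem le_fanout_pow {d n : ℕ} : n ≤ fanout d n ^ (d + 1) := by
  rcases Nat.eq_zero_or_pos n with rfl | hn
  · simp
  · by_contra h
    exact absurd ((le_rootBelow_iff hn).2 (not_le.1 h)) (by simp [fanout])

theorem UniformlyDefinable.le_rootBelow (d : ℕ) {ι : Type} (a : ι) :
    UniformlyDefinable (fun n (v : ι → Fin n) => (v a : ℕ) ≤ rootBelow d n) :=
  (ex (R := fun n v z => (v a : ℕ) ^ (d + 1) = z) (pow d (Sum.inl a) (Sum.inr ()))).congr
    fun n v => by
      rw [le_rootBelow_iff (v a).pos]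
      exact ⟨fun ⟨z, hz⟩ => hz ▸ z.isLt, fun h => ⟨⟨_, h⟩, rfl⟩⟩

theorem foDefinable_rootBelow (d : ℕ) : FODefinable (rootBelow d) := by
  obtain ⟨φ, hφ⟩ := UniformlyDefinable.le_rootBelow d (0 : Fin 1)
  exact ⟨φ, fun n z => hφ n _⟩

theorem UniformlyDefinable.eq_rootBelow (d : ℕ) {ι : Type} (a : ι) :
    UniformlyDefinable (fun n (v : ι → Fin n) => (v a : ℕ) = rootBelow d n) := by
  refine ((le_rootBelow d a).and (all (R := fun n v z => (z : ℕ) ≤ rootBelow d n → z ≤ v a)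
    ((le_rootBelow d (Sum.inr ())).imp (le (Sum.inr ()) (Sum.inl a))))).congr fun n v => ?_
  constructor
  · rintro ⟨h1, h2⟩
    exact h1.antisymm (h2 ⟨rootBelow d n, rootBelow_lt (v a).pos⟩ le_rfl)
  · intro h
    exact ⟨h.le, fun z hz => Fin.le_def.2 (h ▸ hz)⟩

/-- The fanout can equal `n` (for instance if `n = 1`) and then is no element of the domain. The
root always is one, so the product is split as `a * root + a`. -/
theorem UniformlyDefinable.mul_fanout (d : ℕ) {ι : Type} (a b : ι) :
    UniformlyDefinable (fun n (v : ι → Fin n) => (v a : ℕ) * fanout d n = v b) := by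
  refine (ex (R := fun n v z => (z : ℕ) = rootBelow d n ∧
      ∃ t : Fin n, (v a : ℕ) * z = t ∧ (t : ℕ) + v a = v b)
    ((eq_rootBelow d (Sum.inr ())).and (ex (R := fun n v t =>
        (v (Sum.inl a) : ℕ) * v (Sum.inr ()) = t ∧ (t : ℕ) + v (Sum.inl a) = v (Sum.inl b))
      ((mul (Sum.inl (Sum.inl a)) (Sum.inl (Sum.inr ())) (Sum.inr ())).and
        (add (Sum.inr ()) (Sum.inl (Sum.inl a)) (Sum.inl (Sum.inl b))))))).congr fun n v => ?_
  constructor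
  · rintro ⟨z, hz, t, h1, h2⟩
    rw [fanout, ← hz, mul_add, h1, mul_one, h2]
  · intro h
    rw [fanout, mul_add, mul_one] at h
    exact ⟨⟨_, rootBelow_lt (v a).pos⟩, rfl, ⟨_, (Nat.le_of_add_right_le h.le).trans_lt (v b).isLt⟩,
      rfl, h⟩

/-- The power itself may lie outside of `[n]`, so one factor at a time is divided off; the quotients
are at most the dividend and stay inside. -/
theorem UniformlyDefinable.pow_dvd (d j : ℕ) {ι : Type} (a : ι) :
    UniformlyDefinable (fun n (v : ι → Fin n) => fanout d n ^ j ∣ v a) := by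
  induction j generalizing ι with
  | zero => exact UniformlyDefinable.true.congr fun n v => by simp
  | succ j ih =>
    refine (ex (R := fun n v z => fanout d n ^ j ∣ z ∧ (z : ℕ) * fanout d n = v a)
      ((ih (Sum.inr ())).and (mul_fanout d (Sum.inr ()) (Sum.inl a)))).congr fun n v => ?_
    constructor
    · rintro ⟨z, h1, h2⟩
      rw [← h2, pow_succ]
      exact Nat.mul_dvd_mul_right h1 _
    · rintro ⟨q, hq⟩
      rw [pow_succ, mul_right_comm] at hq
      exact ⟨⟨fanout d n ^ j * q,
        (Nat.le_mul_of_pos_right _ (fanout_pos d n)).trans_lt (hq ▸ (v a).isLt)⟩,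
        Dvd.intro _ rfl, hq.symm⟩

/-- The first position of the block with `b` positions that contains `c`. -/
def blockStart (b c : ℕ) : ℕ := c / b * b

/-- The first position after the block with `b` positions that contains `c`. -/
def blockEnd (b c : ℕ) : ℕ := (c / b + 1) * b

theorem blockStart_le (b c : ℕ) : blockStart b c ≤ c := Nat.div_mul_le_self c b

theorem lt_blockEnd {b : ℕ} (hb : 0 < b) (c : ℕ) : c < blockEnd b c := by
  rw [blockEnd, mul_comm]; exact Nat.lt_mul_div_succ c hb

theorem dvd_blockStart (b c : ℕ) : b ∣ blockStart b c := Dvd.intro_left _ rfl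

theorem dvd_blockEnd (b c : ℕ) : b ∣ blockEnd b c := Dvd.intro_left _ rfl

/-- Rounding down gives the greatest multiple that is not larger. With its counterpart
`blockEnd_le`, it supports most later comparisons of block borders. -/
theorem le_blockStart {b a c : ℕ} (ha : b ∣ a) (h : a ≤ c) : a ≤ blockStart b c := by
  obtain ⟨q, rfl⟩ := ha
  rcases Nat.eq_zero_or_pos b with rfl | hb
  · simp
  · rw [blockStart, mul_comm]
    exact Nat.mul_le_mul_right _ ((Nat.le_div_iff_mul_le hb).2 (by rwa [mul_comm]))

theorem blockEnd_le {b a c : ℕ} (ha : b ∣ a) (h : c < a) : blockEnd b c ≤ a := by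
  obtain ⟨q, rfl⟩ := ha
  rw [blockEnd, mul_comm]
  exact Nat.mul_le_mul_left _ (Nat.div_lt_of_lt_mul h)

theorem blockEnd_eq (b c : ℕ) : blockEnd b c = blockStart b c + b := by
  simp [blockEnd, blockStart, add_mul]

theorem blockEnd_mono (b : ℕ) {a c : ℕ} (h : a ≤ c) : blockEnd b a ≤ blockEnd b c :=
  Nat.mul_le_mul_right _ (Nat.succ_le_succ (Nat.div_le_div_right h))

/-- Defined as the greatest multiple of the block size up to `a`, which avoids division. -/
theorem UniformlyDefinable.blockStart (d j : ℕ) {ι : Type} (a b : ι) :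
    UniformlyDefinable
      (fun n (v : ι → Fin n) => (v b : ℕ) = DynFO.blockStart (fanout d n ^ j) (v a)) := by
  refine (((le b a).and (pow_dvd d j b)).and (all (R := fun n v z =>
      fanout d n ^ j ∣ z → z ≤ v a → z ≤ v b)
    ((pow_dvd d j (Sum.inr ())).imp ((le (Sum.inr ()) (Sum.inl a)).imp
      (le (Sum.inr ()) (Sum.inl b)))))).congr fun n v => ?_
  constructor
  · rintro ⟨⟨h1, h2⟩, h3⟩
    exact (le_blockStart h2 h1).antisymm
      (h3 ⟨DynFO.blockStart (fanout d n ^ j) (v a), (blockStart_le _ _).trans_lt (v a).isLt⟩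
        (dvd_blockStart _ _) (blockStart_le _ _))
  · intro h
    simp only [Fin.le_def, h]
    exact ⟨⟨blockStart_le _ _, dvd_blockStart _ _⟩, fun z => le_blockStart⟩

theorem UniformlyDefinable.blockEnd (d j : ℕ) {ι : Type} (a b : ι) :
    UniformlyDefinable
      (fun n (v : ι → Fin n) => (v b : ℕ) = DynFO.blockEnd (fanout d n ^ j) (v a)) := by
  refine (((le b a).not.and (pow_dvd d j b)).and (all (R := fun n v z =>
      fanout d n ^ j ∣ z → ¬ z ≤ v a → v b ≤ z)
    ((pow_dvd d j (Sum.inr ())).imp ((le (Sum.inr ()) (Sum.inl a)).not.imp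
      (le (Sum.inl b) (Sum.inr ())))))).congr fun n v => ?_
  have hlt := lt_blockEnd (Nat.pow_pos (n := j) (fanout_pos d n)) (v a)
  constructor
  · rintro ⟨⟨h1, h2⟩, h3⟩
    -- The true block end is at most `v b`, hence in the domain, so the minimality clause can be
    -- applied to it.
    have h4 := blockEnd_le h2 (not_le.1 h1)
    exact le_antisymm (h3 ⟨DynFO.blockEnd (fanout d n ^ j) (v a), h4.trans_lt (v b).isLt⟩
        (dvd_blockEnd _ _) (not_le.2 hlt)) h4
  · intro h
    simp only [Fin.le_def, h, not_le]
    exact ⟨⟨hlt, dvd_blockEnd _ _⟩, fun z => blockEnd_le⟩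

/-! ## Factors of words with gaps -/

/-- The letter at position `i`, if there is one; positions outside of `[n]` have no letter. -/
def letterAt {α : Type u} {n : ℕ} (w : Fin n → Option α) (i : ℕ) : Option α :=
  if h : i < n then w ⟨i, h⟩ else none

/-- The word at the positions `i` with `a ≤ i < b`. -/
def factor {α : Type u} {n : ℕ} (w : Fin n → Option α) (a b : ℕ) : List α :=
  (List.range' a (b - a)).filterMap (letterAt w)

section Factor

variable {α : Type u} {n : ℕ} (w : Fin n → Option α)

@[simp] theorem factor_self (a : ℕ) : factor w a a = [] := by simp [factor]

/-- Half-open intervals are used so that adjacent factors share a border and concatenate without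
corrections by one. -/
theorem factor_append {a b c : ℕ} (hab : a ≤ b) (hbc : b ≤ c) :
    factor w a b ++ factor w b c = factor w a c := by
  obtain ⟨s, rfl⟩ := Nat.exists_eq_add_of_le hab
  obtain ⟨t, rfl⟩ := Nat.exists_eq_add_of_le hbc
  rw [factor, factor, factor, ← List.filterMap_append]
  congr 1
  rw [Nat.add_sub_cancel_left, Nat.add_sub_cancel_left, add_assoc, Nat.add_sub_cancel_left]
  simp

theorem factor_succ (i : Fin n) : factor w i (i + 1) = (w i).toList := by
  rw [factor, Nat.add_sub_cancel_left]
  cases h : w i <;> simp [letterAt, h]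

theorem factor_empty (a b : ℕ) : factor (fun _ : Fin n => (none : Option α)) a b = [] := by
  simp [factor, letterAt]

theorem factor_update (c : Fin n) (o : Option α) {a b : ℕ} (h : ¬ (a ≤ c ∧ (c : ℕ) < b)) :
    factor (Function.update w c o) a b = factor w a b := by
  refine List.filterMap_congr fun i hi => ?_
  rw [List.mem_range'_1] at hi
  unfold letterAt
  split
  · rw [Function.update_of_ne]
    rintro rfl
    exact h ⟨hi.1, by simp only; omega⟩
  · rfl

theorem subword_eq_factor {l r : Fin n} (h : l ≤ r) : subword w l r = factor w l (r + 1) := by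
  have h1 : subword w l r =
      ((List.range n).filter fun i => (l : ℕ) ≤ i ∧ i ≤ r).filterMap (letterAt w) := by
    rw [← List.map_coe_finRange_eq_range, List.filter_map, List.filterMap_map, subword]
    refine List.filterMap_congr fun i _ => ?_
    simp [letterAt]
  have h2 : (List.range n).filter (fun i => (l : ℕ) ≤ i ∧ i ≤ r) =
      List.range' l (r + 1 - l) := by
    -- The positions are cut into those before, inside and after the interval; the filter keeps
    -- exactly the middle part.
    have hs : List.range n = List.range' 0 l ++ (List.range' l (r + 1 - l) ++
        List.range' (r + 1) (n - (r + 1))) := by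
      obtain ⟨s, hs⟩ := Nat.exists_eq_add_of_le (show (l : ℕ) ≤ r + 1 by omega)
      obtain ⟨t, ht⟩ := Nat.exists_eq_add_of_le (show (r : ℕ) + 1 ≤ n by omega)
      have h1 := List.range'_append (s := l) (m := s) (n := t) (step := 1)
      have h2 := List.range'_append (s := 0) (m := l) (n := s + t) (step := 1)
      rw [one_mul] at h1 h2
      rw [zero_add] at h2
      rw [show n - (r + 1) = t by omega, hs, Nat.add_sub_cancel_left, h1, h2,
        List.range_eq_range', ← add_assoc, ← hs, ← ht]
    rw [hs, List.filter_append, List.filter_append, List.filter_eq_nil_iff.2,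
      List.filter_eq_self.2, List.filter_eq_nil_iff.2] <;>
    simp [List.mem_range'_1] <;> omega
  rw [h1, h2, factor]

theorem subword_eq_nil {l r : Fin n} (h : ¬ l ≤ r) : subword w l r = [] := by
  rw [subword, List.filter_eq_nil_iff.2]
  · rfl
  · intro i _
    simp only [decide_eq_true_eq]
    exact fun hi => h (hi.1.trans hi.2)

end Factor

section Conditions

variable {C : Ctx.{u}} {p l k : ℕ}

/-! ## Terms and conditions that can always be evaluated, with work `1` -/

/-- The evaluation of the term meets all requirements and has work at most `1`. -/
def Term.Simple (t : Term C p l k) : Prop :=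
  ∀ (n : ℕ) (M : (i : C.Inst) → Execution (C.sig i) n),
    (∀ (m : Memory C n M) x y z, t.Ok m x y z) ∧ t.work M ≤ 1

/-- The evaluation of the condition meets all requirements and has work at most `1`. -/
def Cond.Simple (c : Cond C p l k) : Prop :=
  ∀ (n : ℕ) (M : (i : C.Inst) → Execution (C.sig i) n),
    (∀ (m : Memory C n M) x y z, c.Ok m x y z) ∧ c.work M ≤ 1

/-- Work composes by maxima, not sums. Expressions of any size depending only on `d` and the
automaton therefore keep work `1`, provided that they contain no bounded quantifier or `unique`. -/
theorem maxWork_le_one {a : ℕ} {w : Fin a → ℕ} (h : ∀ i, w i ≤ 1) : maxWork w ≤ 1 :=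
  max_le le_rfl (Finset.sup_le fun i _ => h i)

theorem Term.Simple.undef : (Term.undef : Term C p l k).Simple :=
  fun n M => ⟨fun m x y z => by simp only [Term.Ok], by simp only [Term.work, le_refl]⟩

theorem Term.Simple.param (i : Fin p) : (Term.param i : Term C p l k).Simple :=
  fun n M => ⟨fun m x y z => by simp only [Term.Ok], by simp only [Term.work, le_refl]⟩

theorem Term.Simple.index (i : Fin l) : (Term.index i : Term C p l k).Simple :=
  fun n M => ⟨fun m x y z => by simp only [Term.Ok], by simp only [Term.work, le_refl]⟩

theorem Term.Simple.add {s t : Term C p l k} (hs : s.Simple) (ht : t.Simple) :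
    (Term.add s t).Simple := fun n M =>
  ⟨fun m x y z => by simp only [Term.Ok]; exact ⟨(hs n M).1 m x y z, (ht n M).1 m x y z⟩,
    by simp only [Term.work]; exact max_le (hs n M).2 (ht n M).2⟩

theorem Term.Simple.mul {s t : Term C p l k} (hs : s.Simple) (ht : t.Simple) :
    (Term.mul s t).Simple := fun n M =>
  ⟨fun m x y z => by simp only [Term.Ok]; exact ⟨(hs n M).1 m x y z, (ht n M).1 m x y z⟩,
    by simp only [Term.work]; exact max_le (hs n M).2 (ht n M).2⟩

theorem Term.Simple.aux (f : C.aux.Fun) {ts : Fin (C.aux.funArity f) → Term C p l k}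
    (h : ∀ i, (ts i).Simple) : (Term.aux f ts).Simple := fun n M =>
  ⟨fun m x y z => by simp only [Term.Ok]; exact fun i => (h i n M).1 m x y z,
    by simp only [Term.work]; exact maxWork_le_one fun i => (h i n M).2⟩

theorem Cond.Simple.tt : (Cond.tt : Cond C p l k).Simple :=
  fun n M => ⟨fun m x y z => by simp only [Cond.Ok], by simp only [Cond.work, le_refl]⟩

theorem Cond.Simple.eq {s t : Term C p l k} (hs : s.Simple) (ht : t.Simple) :
    (Cond.eq s t).Simple := fun n M =>
  ⟨fun m x y z => by simp only [Cond.Ok]; exact ⟨(hs n M).1 m x y z, (ht n M).1 m x y z⟩,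
    by simp only [Cond.work]; exact max_le (hs n M).2 (ht n M).2⟩

theorem Cond.Simple.le {s t : Term C p l k} (hs : s.Simple) (ht : t.Simple) :
    (Cond.le s t).Simple := fun n M =>
  ⟨fun m x y z => by simp only [Cond.Ok]; exact ⟨(hs n M).1 m x y z, (ht n M).1 m x y z⟩,
    by simp only [Cond.work]; exact max_le (hs n M).2 (ht n M).2⟩

theorem Cond.Simple.aux (R : C.aux.Rel) {ts : Fin (C.aux.relArity R) → Term C p l k}
    (h : ∀ i, (ts i).Simple) : (Cond.aux R ts).Simple := fun n M =>
  ⟨fun m x y z => by simp only [Cond.Ok]; exact fun i => (h i n M).1 m x y z,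
    by simp only [Cond.work]; exact maxWork_le_one fun i => (h i n M).2⟩

theorem Cond.Simple.not {c : Cond C p l k} (hc : c.Simple) : (Cond.not c).Simple := fun n M =>
  ⟨fun m x y z => by simp only [Cond.Ok]; exact (hc n M).1 m x y z,
    by simp only [Cond.work]; exact (hc n M).2⟩

theorem Cond.Simple.and {c d : Cond C p l k} (hc : c.Simple) (hd : d.Simple) :
    (Cond.and c d).Simple := fun n M =>
  ⟨fun m x y z => by simp only [Cond.Ok]; exact ⟨(hc n M).1 m x y z, (hd n M).1 m x y z⟩,
    by simp only [Cond.work]; exact max_le (hc n M).2 (hd n M).2⟩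

theorem Cond.Simple.or {c d : Cond C p l k} (hc : c.Simple) (hd : d.Simple) :
    (Cond.or c d).Simple := fun n M =>
  ⟨fun m x y z => by simp only [Cond.Ok]; exact ⟨(hc n M).1 m x y z, (hd n M).1 m x y z⟩,
    by simp only [Cond.work]; exact max_le (hc n M).2 (hd n M).2⟩

/-! ## Derived conditions -/

open Classical in
/-- A condition with the constant truth value `b`. -/
noncomputable def Cond.const (b : Prop) : Cond C p l k := if b then .tt else .not .tt

/-- Case distinction. -/
def Cond.cases (c d e : Cond C p l k) : Cond C p l k := .or (.and c d) (.and (.not c) e)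

/-- The disjunction of a family of conditions, over the members of a list. -/
noncomputable def Cond.disj {ι : Type} (f : ι → Cond C p l k) (s : List ι) : Cond C p l k :=
  s.foldr (fun i c => .or (f i) c) (.const False)

theorem Cond.Simple.const (b : Prop) : (Cond.const b : Cond C p l k).Simple := by
  unfold Cond.const
  split
  exacts [.tt, .not .tt]

theorem Cond.Simple.cases {c d e : Cond C p l k} (hc : c.Simple) (hd : d.Simple)
    (he : e.Simple) : (Cond.cases c d e).Simple :=
  .or (.and hc hd) (.and (.not hc) he)

theorem Cond.Simple.disj {ι : Type} {f : ι → Cond C p l k} (s : List ι)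
    (h : ∀ i, (f i).Simple) : (Cond.disj f s).Simple := by
  induction s with
  | nil => exact .const False
  | cons i s ih => exact .or (h i) ih

section Eval

variable {n : ℕ} {M : (i : C.Inst) → Execution (C.sig i) n} {m : Memory C n M}
  {x : Fin p → Fin n} {y : Fin l → Fin n} {z : Fin k → Fin n}

/-- A tuple of defined values is unique, so the choice in `applyFun` is harmless. -/
theorem applyFun_eq {a : ℕ} {F : (Fin a → Fin n) → Option (Fin n)} {o : Fin a → Option (Fin n)}
    {x : Fin a → Fin n} (h : Defined o x) : applyFun F o = F x := by
  have hex : ∃ x, Defined o x := ⟨x, h⟩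
  rw [applyFun, dif_pos hex]
  congr 1
  funext j
  exact Option.some_injective _ ((hex.choose_spec j).symm.trans (h j))

theorem Term.eval_add {s t : Term C p l k} {a b c : Fin n} (hc : (c : ℕ) = a + b)
    (hs : s.eval m x y z = some a) (ht : t.eval m x y z = some b) :
    (Term.add s t).eval m x y z = some c := by
  simp only [Term.eval, hs, ht, arithOp, ← hc, c.isLt, dite_true]

theorem Term.eval_mul {s t : Term C p l k} {a b c : Fin n} (hc : (c : ℕ) = a * b)
    (hs : s.eval m x y z = some a) (ht : t.eval m x y z = some b) :
    (Term.mul s t).eval m x y z = some c := by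
  simp only [Term.eval, hs, ht, arithOp, ← hc, c.isLt, dite_true]

theorem Term.eval_aux {f : C.aux.Fun} {ts : Fin (C.aux.funArity f) → Term C p l k}
    {a : Fin (C.aux.funArity f) → Fin n} (h : ∀ j, (ts j).eval m x y z = some (a j)) :
    (Term.aux f ts).eval m x y z = m.aux.fn f a := by
  simp only [Term.eval]
  exact applyFun_eq h

theorem Cond.eval_aux {R : C.aux.Rel} {ts : Fin (C.aux.relArity R) → Term C p l k}
    {a : Fin (C.aux.relArity R) → Fin n} (h : ∀ j, (ts j).eval m x y z = some (a j)) :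
    (Cond.aux R ts).eval m x y z ↔ m.aux.rel R a := by
  simp only [Cond.eval]
  constructor
  · rintro ⟨b, hb, hR⟩
    rwa [show a = b from funext fun j => Option.some_injective _ ((h j).symm.trans (hb j))]
  · exact fun hR => ⟨a, h, hR⟩

theorem Cond.eval_eq {s t : Term C p l k} {a b : Fin n}
    (hs : s.eval m x y z = some a) (ht : t.eval m x y z = some b) :
    (Cond.eq s t).eval m x y z ↔ a = b := by
  simp only [Cond.eval, hs, ht, Option.some.injEq]
  exact ⟨fun ⟨c, h1, h2⟩ => h1.trans h2.symm, fun h => ⟨b, h, rfl⟩⟩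

theorem Cond.eval_le {s t : Term C p l k} {a b : Fin n}
    (hs : s.eval m x y z = some a) (ht : t.eval m x y z = some b) :
    (Cond.le s t).eval m x y z ↔ a ≤ b := by
  simp [Cond.eval, hs, ht]

@[simp] theorem Cond.eval_const (b : Prop) : (Cond.const b).eval m x y z ↔ b := by
  unfold Cond.const
  split <;> simp_all [Cond.eval]

theorem Cond.eval_cases_pos {c d e : Cond C p l k} (h : c.eval m x y z) :
    (Cond.cases c d e).eval m x y z ↔ d.eval m x y z := by
  simp [Cond.cases, Cond.eval, h]

theorem Cond.eval_cases_neg {c d e : Cond C p l k} (h : ¬ c.eval m x y z) :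
    (Cond.cases c d e).eval m x y z ↔ e.eval m x y z := by
  simp [Cond.cases, Cond.eval, h]

theorem Cond.eval_disj {ι : Type} (f : ι → Cond C p l k) (s : List ι) :
    (Cond.disj f s).eval m x y z ↔ ∃ i ∈ s, (f i).eval m x y z := by
  induction s with
  | nil => simp [Cond.disj]
  | cons i s ih =>
    rw [show Cond.disj f (i :: s) = .or (f i) (Cond.disj f s) from rfl, Cond.eval, ih]
    simp only [List.mem_cons, exists_eq_or_imp]

end Eval

/-! ## Conditions for the behaviour of a finite automaton -/

section Automaton

variable {Q : Type}

/-- Conditions, for all pairs of states, that compose two binary relations on the states. -/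
noncomputable def Cond.comp [Fintype Q] (X Y : Q → Q → Cond C p l k) (q r : Q) : Cond C p l k :=
  Cond.disj (fun s => .and (X q s) (Y s r)) (Finset.univ : Finset Q).toList

/-- Conditions, for all pairs of states, for reading a fixed word. -/
noncomputable def Cond.word {α : Type v} (D : DFA α Q) (u : List α) (q r : Q) : Cond C p l k :=
  .const (D.evalFrom q u = r)

theorem Cond.Simple.comp [Fintype Q] {X Y : Q → Q → Cond C p l k} (hX : ∀ q r, (X q r).Simple)
    (hY : ∀ q r, (Y q r).Simple) (q r : Q) : (Cond.comp X Y q r).Simple :=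
  .disj _ fun s => .and (hX q s) (hY s r)

variable {n : ℕ} {M : (i : C.Inst) → Execution (C.sig i) n} {m : Memory C n M}
  {x : Fin p → Fin n} {y : Fin l → Fin n} {z : Fin k → Fin n} {α : Type v} {D : DFA α Q}

/-- The conditions describe the transitions of the automaton when it reads the word `u`. -/
def Reads (D : DFA α Q) (m : Memory C n M) (x : Fin p → Fin n) (y : Fin l → Fin n)
    (z : Fin k → Fin n) (X : Q → Q → Cond C p l k) (u : List α) : Prop :=
  ∀ q r, (X q r).eval m x y z ↔ D.evalFrom q u = r

theorem Reads.word (u : List α) : Reads D m x y z (Cond.word D u) u :=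
  fun q r => by simp [Cond.word]

/-- The run on `u ++ u'` passes through the state `D.evalFrom q u` and no other. Since the state set
is fixed, this state is found by a finite disjunction instead of a quantifier over the domain. -/
theorem Reads.comp [Fintype Q] {X Y : Q → Q → Cond C p l k} {u u' : List α}
    (hX : Reads D m x y z X u) (hY : Reads D m x y z Y u') : Reads D m x y z (Cond.comp X Y) (u ++ u') := by
  intro q r
  rw [Cond.comp, Cond.eval_disj, DFA.evalFrom_of_append]
  simp only [Finset.mem_toList, Finset.mem_univ, true_and, Cond.eval]
  constructor
  · rintro ⟨s, h1, h2⟩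
    rw [(hX _ _).1 h1, (hY _ _).1 h2]
  · exact fun h => ⟨_, (hX _ _).2 rfl, (hY _ _).2 h⟩

end Automaton

end Conditions

/-! ## Update rules that consist of a single expression -/

section ExprRule

variable {C : Ctx.{u}} {p a : ℕ}

/-- The update rule that returns the value of an expression, without any computations before. -/
def exprRule {E : ℕ → Type u} (l : ℕ) (g : Fin l → Bound)
    (target : Fin a → Term C.auxOnly p l 0) (e : E l) : UpdateRule C p a E where
  initial := .stmt .skip
  numIndex := l
  bound := g
  target := target
  main := .ret e

variable {l : ℕ} {g : Fin l → Bound} {target : Fin a → Term C.auxOnly p l 0} {n : ℕ}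
  {M : (i : C.Inst) → Execution (C.sig i) n} {m : Memory C n M} {x : Fin p → Fin n}

theorem exprRule_okRel {e : Cond C p l 0} (ht : ∀ i, (target i).Simple) (he : e.Simple) :
    (exprRule (E := fun l => Cond C p l 0) l g target e).OkRel m x :=
  ⟨by simp [exprRule, InitProc.Ok, Stmt.Ok],
    fun y _ => ⟨fun j => (ht j n _).1 _ _ _ _, trivial, (he n M).1 _ _ _ _⟩⟩

/-- Several index tuples may have the same target. If the returned value depends on the target only,
they all return `P`; a position that no tuple reaches keeps its old value, which then has to be `P`
already. -/
theorem exprRule_newRel_iff {e : Cond C p l 0} {old : (Fin a → Fin n) → Prop}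
    {t : Fin a → Fin n} {P : Prop}
    (h1 : ∀ y : Fin l → Fin n,
      (∀ j, (target j).eval (auxMemory m.aux) x y Fin.elim0 = some (t j)) →
        (e.eval m x y Fin.elim0 ↔ P))
    (h2 : (¬ ∃ y : Fin l → Fin n, (∀ j, (y j : ℕ) ≤ (g j).1 n) ∧
      ∀ j, (target j).eval (auxMemory m.aux) x y Fin.elim0 = some (t j)) → (old t ↔ P)) :
    (exprRule (E := fun l => Cond C p l 0) l g target e).newRel old m x t ↔ P := by
  have key : ∀ y : Fin l → Fin n,
      (exprRule (E := fun l => Cond C p l 0) l g target e).main.evalRel x y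
        ((exprRule (E := fun l => Cond C p l 0) l g target e).initial.exec x m) ↔
      e.eval m x y Fin.elim0 := fun y => by
    simp only [exprRule, InitProc.exec, Stmt.exec, MainProc.evalRel, MainProc.exec]
  rw [UpdateRule.newRel]
  constructor
  · rintro (⟨ho, hy⟩ | ⟨y, hy, hP⟩)
    · exact (h2 hy).1 ho
    · exact (h1 y hy.2).1 ((key y).1 hP)
  · intro hP
    by_cases hy : ∃ y : Fin l → Fin n, (∀ j, (y j : ℕ) ≤ (g j).1 n) ∧
      ∀ j, (target j).eval (auxMemory m.aux) x y Fin.elim0 = some (t j)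
    · obtain ⟨y, hy⟩ := hy
      exact Or.inr ⟨y, hy, (key y).2 ((h1 y hy.2).2 hP)⟩
    · exact Or.inl ⟨(h2 hy).2 hP, hy⟩

theorem exprRule_work_le {E : ℕ → Type u} {e : E l} (w : E l → ℕ)
    (ht : ∀ i, (target i).Simple) (he : w e ≤ 1) :
    (exprRule (E := E) l g target e).work M w ≤ ∏ j, ((g j).1 n + 1) := by
  have h1 : 1 ≤ ∏ j, ((g j).1 n + 1) := Finset.one_le_prod' fun j _ => Nat.le_add_left 1 _
  refine max_le (by simpa [exprRule, InitProc.work, Stmt.work] using h1) ?_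
  exact (Nat.mul_le_mul_left _ (max_le he (maxWork_le_one fun i => (ht i n _).2))).trans
    (mul_one _).le

/-- The update rule that does not change a function. -/
def keepRule (a : ℕ) : UpdateRule C p (a + 1) (fun l => Term C p l 0) :=
  exprRule 0 Fin.elim0 (fun _ => .undef) .undef

/-- The arity has to be positive: only then does an undefined target coordinate exclude every
position. -/
theorem not_keepRule_updates {A : Str C.aux n} {y : Fin 0 → Fin n} {t : Fin (a + 1) → Fin n} :
    ¬ (keepRule a : UpdateRule C p (a + 1) _).Updates A x y t := fun h => by
  have := h.2 0
  simp [keepRule, exprRule, Term.eval] at this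

theorem keepRule_okFun : (keepRule a : UpdateRule C p (a + 1) _).OkFun m x :=
  ⟨⟨by simp [keepRule, exprRule, InitProc.Ok, Stmt.Ok],
    fun y _ => ⟨fun j => (Term.Simple.undef n _).1 _ _ _ _, trivial,
      (Term.Simple.undef n M).1 _ _ _ _⟩⟩,
    fun _ _ _ h => absurd h not_keepRule_updates⟩

theorem keepRule_newFun (old : (Fin (a + 1) → Fin n) → Option (Fin n)) :
    (keepRule a : UpdateRule C p (a + 1) _).newFun old m x = old := by
  funext t
  exact dif_neg fun ⟨y, h⟩ => not_keepRule_updates h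

theorem keepRule_work_le : (keepRule a : UpdateRule C p (a + 1) _).work M (Term.work M) ≤ 1 :=
  (exprRule_work_le _ (fun _ => .undef) (Term.Simple.undef n M).2).trans (by simp)

end ExprRule

/-! ## The program for range membership -/

namespace RangeMember

/-- The auxiliary relations: the positions with a letter, the transitions of the automaton for the
letters, and its transitions for the words at sequences of blocks of level `j` that lie in the same
block of level `j + 1`. -/
inductive AuxRel (d : ℕ) (Q : Type) : Type
  | occupied
  | letter (q r : Q)
  | segment (j : Fin (d + 2)) (q r : Q)
  deriving Fintype

/-- The auxiliary functions, which never change: the root of the domain size (as a constant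
function), the first position of a block of level `j`, and the first position after it. -/
inductive AuxFun (d : ℕ) : Type
  | root
  | start (j : Fin (d + 2))
  | finish (j : Fin (d + 2))
  deriving Fintype

/-- The auxiliary schema. -/
def schema (d : ℕ) (Q : Type) [Fintype Q] : Schema where
  Rel := AuxRel d Q
  Fun := AuxFun d
  relArity
    | .occupied => 1
    | .letter _ _ => 1
    | .segment _ _ _ => 2
  funArity := fun _ => 1

/-- The symbols of the program. -/
def ctx (d : ℕ) (Q : Type) [Fintype Q] : Ctx.{u} where
  aux := schema d Q
  tmp := Schema.empty
  Inst := Empty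
  sig := fun i => i.elim

section Definitions

variable {d : ℕ} {Q : Type} [Fintype Q] {p l k : ℕ}

/-- The index of a level. -/
def level (d j : ℕ) : Fin (d + 2) := Fin.ofNat (d + 2) j

/-- The root of the domain size; the argument is arbitrary. -/
def rootT (t : Term (ctx.{u} d Q) p l k) : Term (ctx.{u} d Q) p l k :=
  .aux (C := ctx.{u} d Q) AuxFun.root fun _ => t

/-- The first position of the block of level `j` that contains `t`. -/
def startT (j : ℕ) (t : Term (ctx.{u} d Q) p l k) : Term (ctx.{u} d Q) p l k :=
  .aux (C := ctx.{u} d Q) (AuxFun.start (level d j)) fun _ => t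

/-- The first position after the block of level `j` that contains `t`. -/
def finishT (j : ℕ) (t : Term (ctx.{u} d Q) p l k) : Term (ctx.{u} d Q) p l k :=
  .aux (C := ctx.{u} d Q) (AuxFun.finish (level d j)) fun _ => t

/-- Multiplication by the number of positions in a block of level `j`. -/
def scaleT : ℕ → Term (ctx.{u} d Q) p l k → Term (ctx.{u} d Q) p l k
  | 0, t => t
  | j + 1, t => .add (.mul (scaleT j t) (rootT (scaleT j t))) (scaleT j t)

/-- There is a letter at position `t`. -/
def occupiedC (t : Term (ctx.{u} d Q) p l k) : Cond (ctx.{u} d Q) p l k :=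
  .aux (C := ctx.{u} d Q) AuxRel.occupied fun _ => t

/-- The transitions for the letter at position `t`. -/
def letterC (t : Term (ctx.{u} d Q) p l k) (q r : Q) : Cond (ctx.{u} d Q) p l k :=
  .aux (C := ctx.{u} d Q) (AuxRel.letter q r) fun _ => t

/-- The transitions for the word from `s` to `t`, at blocks of level `j`. -/
def segmentC (j : ℕ) (s t : Term (ctx.{u} d Q) p l k) (q r : Q) : Cond (ctx.{u} d Q) p l k :=
  .aux (C := ctx.{u} d Q) (AuxRel.segment (level d j) q r)
    (show Fin 2 → Term (ctx.{u} d Q) p l k from ![s, t])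

variable {α : Type u} (D : DFA α Q)

/-- The new letter of a position with the letter `o` that is changed. -/
def newLetter : WordChange α → Option α → Option α
  | .set σ, o => o.or (some σ)
  | .reset, _ => none

/-- The transitions for the new letter of the changed position. -/
noncomputable def newLetterC : WordChange α → Q → Q → Cond (ctx.{u} d Q) 1 l k
  | .set σ, q, r => .cases (occupiedC (.param 0)) (letterC (.param 0) q r) (.word D [σ] q r)
  | .reset, q, r => .word D [] q r

/-- The transitions for the new word from `s` to `t`, given those for the block of level `j` of the
changed position, which is between `s` and `t`. -/
noncomputable def spliceC (j : ℕ) (X : Q → Q → Cond (ctx.{u} d Q) 1 l k)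
    (s t : Term (ctx.{u} d Q) 1 l k) : Q → Q → Cond (ctx.{u} d Q) 1 l k :=
  .comp (segmentC j s (startT j (.param 0))) (.comp X (segmentC j (finishT j (.param 0)) t))

/-- The transitions for the new word at the block of level `j` of the changed position. -/
noncomputable def blockC (c : WordChange α) : ℕ → Q → Q → Cond (ctx.{u} d Q) 1 l k
  | 0 => newLetterC D c
  | j + 1 => spliceC j (blockC c j) (startT (j + 1) (.param 0)) (finishT (j + 1) (.param 0))

/-- The first block of a segment that is updated. -/
def leftT (j : ℕ) : Term (ctx.{u} d Q) 1 2 0 :=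
  .add (startT (j + 1) (.param 0)) (scaleT j (.index 0))

/-- The end of a segment that is updated. -/
def rightT (j : ℕ) : Term (ctx.{u} d Q) 1 2 0 :=
  finishT j (.add (startT (j + 1) (.param 0)) (scaleT j (.index 1)))

/-- The new transitions for the segment from `leftT j` to `rightT j`. -/
noncomputable def newSegmentC (c : WordChange α) (j : ℕ) (q r : Q) : Cond (ctx.{u} d Q) 1 2 0 :=
  .cases (.and (.le (leftT j) (.param 0)) (.not (.le (rightT j) (.param 0))))
    (spliceC j (blockC D c j) (leftT j) (rightT j) q r) (segmentC j (leftT j) (rightT j) q r)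

/-- The transitions for the word at the positions `i` with `s ≤ i < t`, where `s` and `t` are the
first positions of blocks of level `j`, and `f` is the number of the levels above. -/
noncomputable def rangeC : ℕ → ℕ → Term (ctx.{u} d Q) p l k → Term (ctx.{u} d Q) p l k →
    Q → Q → Cond (ctx.{u} d Q) p l k
  | 0, _, _, _ => .word D []
  | f + 1, j, s, t => fun q r =>
    .cases (.eq (startT (j + 1) s) (startT (j + 1) t)) (segmentC j s t q r)
      (.comp (segmentC j s (finishT (j + 1) s))
        (.comp (rangeC f (j + 1) (finishT (j + 1) s) (startT (j + 1) t))
          (segmentC j (startT (j + 1) t) t)) q r)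

/-- The condition for range queries. -/
noncomputable def queryC : Cond (ctx.{u} d Q) 2 0 0 :=
  .cases (.le (.param 0) (.param 1))
    (.disj (fun q => .and (.const (q ∈ D.accept))
      (.comp (rangeC D (d + 1) 0 (.param 0) (.param 1)) (letterC (.param 1)) D.start q))
      (Finset.univ : Finset Q).toList)
    (.const (D.start ∈ D.accept))

/-- The value of an auxiliary function for the argument `c`, if it is less than `n`. -/
def AuxFun.value (n : ℕ) : AuxFun d → ℕ → ℕ
  | .root, _ => rootBelow d n
  | .start j, c => blockStart (fanout d n ^ (j : ℕ)) c
  | .finish j, c => blockEnd (fanout d n ^ (j : ℕ)) c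

theorem AuxFun.uniformlyDefinable (f : AuxFun d) :
    UniformlyDefinable fun n (v : Fin 2 → Fin n) => (v 1 : ℕ) = f.value n (v 0) := by
  cases f with
  | root => exact .eq_rootBelow d 1
  | start j => exact .blockStart d j 0 1
  | finish j => exact .blockEnd d j 0 1

open Classical in
/-- The rules of the program for range membership. -/
noncomputable def rules [Finite α] (d : ℕ) : Rules (ctx.{u} d Q) (rangeMemberSig α) where
  relInit
    | .occupied => ⊥
    | .letter q r => if q = r then ⊤ else ⊥
    | .segment _ q r => if q = r then ⊤ else ⊥
  funInit f := (AuxFun.uniformlyDefinable f).choose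
  relRule
    | .set _, .occupied => exprRule 0 Fin.elim0 (fun _ => Term.param (0 : Fin 1)) Cond.tt
    | .reset, .occupied => exprRule 0 Fin.elim0 (fun _ => Term.param (0 : Fin 1)) (.not .tt)
    | c, .letter q r =>
      exprRule 0 Fin.elim0 (fun _ => Term.param (0 : Fin 1)) (newLetterC D c q r)
    | c, .segment j q r =>
      exprRule 2 (fun _ => ⟨rootBelow d, foDefinable_rootBelow d⟩)
        (show Fin 2 → Term (ctx.{u} d Q) 1 2 0 from ![leftT j, rightT j])
        (newSegmentC D c j q r)
  funRule _ _ := keepRule 0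
  relQueryRule _ := .ret (queryC D)
  funQueryRule q := q.elim

end Definitions

section Evaluation

variable {d : ℕ} {Q : Type} [Fintype Q] {p l k : ℕ} {α : Type u} (D : DFA α Q)

/-! ### All terms and conditions of the program are simple -/

section Simple

variable {s t : Term (ctx.{u} d Q) p l k}

theorem rootT_simple (ht : t.Simple) : (rootT t).Simple := .aux _ fun _ => ht

theorem startT_simple (j : ℕ) (ht : t.Simple) : (startT j t).Simple := .aux _ fun _ => ht

theorem finishT_simple (j : ℕ) (ht : t.Simple) : (finishT j t).Simple := .aux _ fun _ => ht

theorem scaleT_simple (j : ℕ) (ht : t.Simple) : (scaleT j t).Simple := by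
  induction j with
  | zero => exact ht
  | succ j ih => exact .add (.mul ih (rootT_simple ih)) ih

theorem letterC_simple (ht : t.Simple) (q r : Q) : (letterC t q r).Simple := .aux _ fun _ => ht

theorem segmentC_simple (j : ℕ) (hs : s.Simple) (ht : t.Simple) (q r : Q) :
    (segmentC j s t q r).Simple :=
  .aux _ (show ∀ i : Fin 2, (![s, t] i).Simple from Fin.forall_fin_two.2 ⟨hs, ht⟩)

theorem newLetterC_simple (c : WordChange α) (q r : Q) :
    (newLetterC (d := d) (l := l) (k := k) D c q r).Simple := by
  cases c with
  | set σ => exact .cases (.aux _ fun _ => .param 0) (letterC_simple (.param 0) q r) (.const _)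
  | reset => exact .const _

theorem spliceC_simple (j : ℕ) {X : Q → Q → Cond (ctx.{u} d Q) 1 l k}
    (hX : ∀ q r, (X q r).Simple) {s t : Term (ctx.{u} d Q) 1 l k} (hs : s.Simple)
    (ht : t.Simple) (q r : Q) : (spliceC j X s t q r).Simple :=
  .comp (segmentC_simple j hs (startT_simple j (.param 0)))
    (.comp hX (segmentC_simple j (finishT_simple j (.param 0)) ht)) q r

theorem blockC_simple (c : WordChange α) (j : ℕ) (q r : Q) :
    (blockC (d := d) (l := l) (k := k) D c j q r).Simple := by
  induction j generalizing q r with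
  | zero => exact newLetterC_simple D c q r
  | succ j ih =>
    exact spliceC_simple j ih (startT_simple _ (.param 0)) (finishT_simple _ (.param 0)) q r

theorem leftT_simple (j : ℕ) : (leftT j : Term (ctx.{u} d Q) 1 2 0).Simple :=
  .add (startT_simple _ (.param 0)) (scaleT_simple j (.index 0))

theorem rightT_simple (j : ℕ) : (rightT j : Term (ctx.{u} d Q) 1 2 0).Simple :=
  finishT_simple j (.add (startT_simple _ (.param 0)) (scaleT_simple j (.index 1)))

theorem newSegmentC_simple (c : WordChange α) (j : ℕ) (q r : Q) :
    (newSegmentC (d := d) D c j q r).Simple :=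
  .cases (.and (.le (leftT_simple j) (.param 0)) (.not (.le (rightT_simple j) (.param 0))))
    (spliceC_simple j (blockC_simple D c j) (leftT_simple j) (rightT_simple j) q r)
    (segmentC_simple j (leftT_simple j) (rightT_simple j) q r)

theorem rangeC_simple (f j : ℕ) {s t : Term (ctx.{u} d Q) p l k} (hs : s.Simple)
    (ht : t.Simple) (q r : Q) : (rangeC D f j s t q r).Simple := by
  induction f generalizing j s t q r with
  | zero => exact .const _
  | succ f ih =>
    exact .cases (.eq (startT_simple _ hs) (startT_simple _ ht)) (segmentC_simple j hs ht q r)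
      (.comp (segmentC_simple j hs (finishT_simple _ hs))
        (.comp (ih _ (finishT_simple _ hs) (startT_simple _ ht))
          (segmentC_simple j (startT_simple _ ht) ht)) q r)

theorem queryC_simple : (queryC (d := d) D).Simple :=
  .cases (.le (.param 0) (.param 1))
    (.disj _ fun q => .and (.const _) (.comp (rangeC_simple D _ _ (.param 0) (.param 1))
      (letterC_simple (.param 1)) _ q)) (.const _)

end Simple

/-! ### The invariant -/

/-- `a` and `b` are multiples of `B` with `a ≤ b`, in the same block of `B'` positions, where the
end of this block is included. -/
structure Aligned (B B' a b : ℕ) : Prop where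
  left : B ∣ a
  right : B ∣ b
  le : a ≤ b
  le_blockEnd : b ≤ blockEnd B' a

theorem Aligned.take {B B' a b c : ℕ} (h : Aligned B B' a b) (hc : B ∣ c) (h1 : a ≤ c)
    (h2 : c ≤ b) : Aligned B B' a c :=
  ⟨h.left, hc, h1, h2.trans h.le_blockEnd⟩

/-- Moving the left end to the right can only move its block end to the right. An empty remainder
may already start in the next large block, which the definition tolerates. -/
theorem Aligned.drop {B B' a b c : ℕ} (h : Aligned B B' a b) (hc : B ∣ c) (h1 : a ≤ c)
    (h2 : c ≤ b) : Aligned B B' c b :=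
  ⟨hc, h.right, h2, h.le_blockEnd.trans (blockEnd_mono _ h1)⟩

/-- The auxiliary structure `A` is the one for the word `w`. -/
structure Invariant {n : ℕ} (w : Fin n → Option α) (A : Str (schema d Q) n) : Prop where
  value : ∀ (f : AuxFun d) (a b : Fin n), (b : ℕ) = f.value n a → A.fn f (fun _ => a) = some b
  occupied : ∀ a, A.rel .occupied (fun _ => a) ↔ (w a).isSome
  letter : ∀ q r a, A.rel (.letter q r) (fun _ => a) ↔ D.evalFrom q (w a).toList = r
  segment : ∀ j : ℕ, j ≤ d → ∀ (q r) (a b : Fin n),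
    Aligned (fanout d n ^ j) (fanout d n ^ (j + 1)) a b →
      (A.rel (.segment (level d j) q r) ![a, b] ↔ D.evalFrom q (factor w a b) = r)

-- Reading words off a structure that satisfies the invariant.

section Eval

variable {n : ℕ} {M : (i : (ctx.{u} d Q).Inst) → Execution ((ctx.{u} d Q).sig i) n}
  {m : Memory (ctx.{u} d Q) n M} {x : Fin p → Fin n} {y : Fin l → Fin n} {z : Fin k → Fin n}
  {s t : Term (ctx.{u} d Q) p l k} {w : Fin n → Option α} {D}

theorem level_val {j : ℕ} (h : j ≤ d + 1) : (level d j : ℕ) = j :=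
  Nat.mod_eq_of_lt (by omega)

namespace Invariant

variable (hI : Invariant D w m.aux)
include hI

theorem eval_rootT {a b : Fin n} (ht : t.eval m x y z = some a) (hb : (b : ℕ) = rootBelow d n) :
    (rootT t).eval m x y z = some b :=
  (Term.eval_aux (a := fun _ => a) fun _ => ht).trans (hI.value _ a b hb)

theorem eval_startT {j : ℕ} (hj : j ≤ d + 1) {a b : Fin n} (ht : t.eval m x y z = some a)
    (hb : (b : ℕ) = blockStart (fanout d n ^ j) a) : (startT j t).eval m x y z = some b :=
  (Term.eval_aux (a := fun _ => a) fun _ => ht).trans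
    (hI.value _ a b (by rw [AuxFun.value, level_val hj, hb]))

theorem eval_finishT {j : ℕ} (hj : j ≤ d + 1) {a b : Fin n} (ht : t.eval m x y z = some a)
    (hb : (b : ℕ) = blockEnd (fanout d n ^ j) a) : (finishT j t).eval m x y z = some b :=
  (Term.eval_aux (a := fun _ => a) fun _ => ht).trans
    (hI.value _ a b (by rw [AuxFun.value, level_val hj, hb]))

/-- All intermediate sums and products are bounded by the final value `b`, so none of the partial
operations is undefined, even if the scaling factor is outside of the domain. -/
theorem eval_scaleT (j : ℕ) {a b : Fin n} (ht : t.eval m x y z = some a)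
    (hb : (b : ℕ) = a * fanout d n ^ j) : (scaleT j t).eval m x y z = some b := by
  induction j generalizing b with
  | zero =>
    rw [pow_zero, mul_one] at hb
    rwa [scaleT, Fin.ext hb]
  | succ j ih =>
    have hb' : (b : ℕ) = a * fanout d n ^ j * rootBelow d n + a * fanout d n ^ j := by
      rw [hb, fanout]; ring
    have hlt := b.isLt
    have h := ih (b := ⟨a * fanout d n ^ j, by omega⟩) rfl
    have h' := hI.eval_rootT (b := ⟨_, rootBelow_lt a.pos⟩) h rfl
    exact Term.eval_add (a := ⟨a * fanout d n ^ j * rootBelow d n, by omega⟩) hb'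
      (Term.eval_mul rfl h h') h

theorem reads_letterC {a : Fin n} (ht : t.eval m x y z = some a) :
    Reads D m x y z (letterC t) (w a).toList := fun q r =>
  (Cond.eval_aux (a := fun _ => a) fun _ => ht).trans (hI.letter q r a)

theorem reads_segmentC {j : ℕ} (hj : j ≤ d) {a b : Fin n} (hs : s.eval m x y z = some a)
    (ht : t.eval m x y z = some b)
    (hab : Aligned (fanout d n ^ j) (fanout d n ^ (j + 1)) a b) :
    Reads D m x y z (segmentC j s t) (factor w a b) := fun q r =>
  (Cond.eval_aux (C := ctx.{u} d Q) (R := AuxRel.segment (level d j) q r)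
    (a := (![a, b] : Fin 2 → Fin n))
    (Fin.forall_fin_two.2 ⟨hs, ht⟩)).trans (hI.segment j hj q r a b hab)

/-- Induction on the number of levels above. If the ends lie in different blocks of level `j + 1`,
the word splits into the rest of the block of `a`, a middle part aligned to level `j + 1`, and the
beginning of the block of `b`; only the middle part needs the induction hypothesis. -/
theorem reads_rangeC {f j : ℕ} (hj : j + f = d + 1) {a b : Fin n}
    (hs : s.eval m x y z = some a) (ht : t.eval m x y z = some b)
    (ha : fanout d n ^ j ∣ a) (hb : fanout d n ^ j ∣ b) (hab : a ≤ b) :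
    Reads D m x y z (rangeC D f j s t) (factor w a b) := by
  have hab' := Fin.le_def.1 hab
  induction f generalizing j s t a b with
  | zero =>
    obtain rfl : j = d + 1 := hj
    -- At the top level, `0` is the only block border in the domain, so the remaining word is empty.
    have h0 : ∀ c : Fin n, fanout d n ^ (d + 1) ∣ c → (c : ℕ) = 0 := fun c hc =>
      Nat.eq_zero_of_dvd_of_lt hc (c.isLt.trans_le le_fanout_pow)
    rw [h0 a ha, h0 b hb, factor_self]
    exact .word []
  | succ f ih =>
    have hpos : 0 < fanout d n ^ (j + 1) := Nat.pow_pos (fanout_pos d n)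
    have hdvd : fanout d n ^ j ∣ fanout d n ^ (j + 1) := pow_dvd_pow _ (Nat.le_succ j)
    have hlt := lt_blockEnd hpos b
    set a' : Fin n := ⟨blockStart (fanout d n ^ (j + 1)) a, (blockStart_le _ _).trans_lt a.isLt⟩
      with ha'
    set b' : Fin n := ⟨blockStart (fanout d n ^ (j + 1)) b, (blockStart_le _ _).trans_lt b.isLt⟩
      with hb'
    have hsa := hI.eval_startT (j := j + 1) (b := a') (by omega) hs rfl
    have htb := hI.eval_startT (j := j + 1) (b := b') (by omega) ht rfl
    have hend : blockEnd (fanout d n ^ (j + 1)) b = b' + fanout d n ^ (j + 1) :=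
      blockEnd_eq _ _
    by_cases hc : a' = b'
    · have h : Aligned (fanout d n ^ j) (fanout d n ^ (j + 1)) a b := by
        refine ⟨ha, hb, hab', hlt.le.trans ?_⟩
        rw [hend, ← hc, blockEnd_eq]
      exact fun q r => (Cond.eval_cases_pos ((Cond.eval_eq hsa htb).2 hc)).trans
        (hI.reads_segmentC (by omega) hs ht h q r)
    -- The block of `a` ends no later than that of `b` starts. In particular its end is in the
    -- domain, and the `finishT` term is defined.
    · have hab2 : blockEnd (fanout d n ^ (j + 1)) a ≤ b' := by
        refine blockEnd_le (dvd_blockStart _ _)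
          (not_le.1 fun hle => hc (Fin.ext (le_antisymm ?_ ?_)))
        · exact le_blockStart (dvd_blockStart _ _) ((blockStart_le _ _).trans hab')
        · exact le_blockStart (dvd_blockStart _ _) hle
      have hle : (b' : ℕ) ≤ b := blockStart_le _ _
      set e : Fin n := ⟨blockEnd (fanout d n ^ (j + 1)) a, hab2.trans_lt b'.isLt⟩ with he
      have hse := hI.eval_finishT (j := j + 1) (b := e) (by omega) hs rfl
      have hae : (a : ℕ) ≤ e := (lt_blockEnd hpos a).le
      have heb : (e : ℕ) ≤ b' := hab2
      rw [← factor_append w hae (heb.trans hle), ← factor_append w heb hle]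
      refine fun q r => (Cond.eval_cases_neg fun h => hc ((Cond.eval_eq hsa htb).1 h)).trans
        (Reads.comp ?_ (.comp ?_ ?_) q r)
      · exact hI.reads_segmentC (by omega) hs hse
          ⟨ha, hdvd.trans (dvd_blockEnd _ _), hae, le_rfl⟩
      · exact ih (by omega) hse htb (dvd_blockEnd _ _) (dvd_blockStart _ _) heb heb
      · refine hI.reads_segmentC (by omega) htb ht
          ⟨hdvd.trans (dvd_blockStart _ _), hb, hle, hlt.le.trans ?_⟩
        rw [hend, blockEnd_eq]
        exact Nat.add_le_add_right (le_blockStart (dvd_blockStart _ _) le_rfl) _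

/-- The half-open interval for the query ends at `x 1 + 1`, which may be `n` and thus no element of
the domain. So the levels are used up to `x 1`, and the letter at `x 1` is appended separately. -/
theorem eval_queryC {x : Fin 2 → Fin n} :
    (queryC D).eval m x Fin.elim0 Fin.elim0 ↔ subword w (x 0) (x 1) ∈ D.accepts := by
  have h0 : (Term.param 0 : Term (ctx.{u} d Q) 2 0 0).eval m x Fin.elim0 Fin.elim0 =
    some (x 0) := by simp only [Term.eval]
  have h1 : (Term.param 1 : Term (ctx.{u} d Q) 2 0 0).eval m x Fin.elim0 Fin.elim0 =
    some (x 1) := by simp only [Term.eval]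
  rw [DFA.mem_accepts, queryC]
  by_cases hle : x 0 ≤ x 1
  · rw [Cond.eval_cases_pos ((Cond.eval_le h0 h1).2 hle), Cond.eval_disj, subword_eq_factor w hle,
      ← factor_append w (Fin.le_def.1 hle) (Nat.le_succ _), factor_succ]
    have hr := (hI.reads_rangeC (f := d + 1) (j := 0) (by omega) h0 h1 (by simp) (by simp)
      hle).comp (hI.reads_letterC h1)
    simp only [Finset.mem_toList, Finset.mem_univ, true_and, Cond.eval, Cond.eval_const, hr _ _]
    constructor
    · rintro ⟨q, hq, h⟩
      rwa [DFA.eval, h]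
    · exact fun h => ⟨_, h, rfl⟩
  · rw [Cond.eval_cases_neg fun h => hle ((Cond.eval_le h0 h1).1 h), subword_eq_nil w hle]
    simp

end Invariant

end Eval

end Evaluation

section Preservation

variable {d : ℕ} {Q : Type} [Fintype Q] {α : Type u} {D : DFA α Q}

/-! ### Preservation of the invariant -/

/-- The positions of the blocks of a segment, relative to the block of the next level. -/
theorem exists_digit {B K s a : ℕ} (hs : B ∣ s) (ha : B ∣ a) (h1 : s ≤ a) (h2 : a < s + B * K) :
    ∃ i < K, a = s + i * B := by
  obtain ⟨i, hi⟩ := (Nat.dvd_sub ha hs)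
  refine ⟨i, ?_, by rw [mul_comm, ← hi]; omega⟩
  exact Nat.lt_of_mul_lt_mul_left (a := B) (by omega)

/-- The word after a change. -/
def changeWord {n : ℕ} (c : WordChange α) (i : Fin n) (w : Fin n → Option α) : Fin n → Option α :=
  Function.update w i (newLetter c (w i))

section Update

variable {n : ℕ} {M : (i : (ctx.{u} d Q).Inst) → Execution ((ctx.{u} d Q).sig i) n}
  {m : Memory (ctx.{u} d Q) n M} {l k : ℕ} {x : Fin 1 → Fin n} {y : Fin l → Fin n}
  {z : Fin k → Fin n} {s t : Term (ctx.{u} d Q) 1 l k} {w : Fin n → Option α}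

theorem eval_param (x : Fin 1 → Fin n) :
    (Term.param 0 : Term (ctx.{u} d Q) 1 l k).eval m x y z = some (x 0) := by
  simp only [Term.eval]

namespace Invariant

variable (hI : Invariant D w m.aux)
include hI

theorem reads_newLetterC (c : WordChange α) :
    Reads D m x y z (newLetterC D c) (newLetter c (w (x 0))).toList := by
  intro q r
  cases c with
  | reset => exact Reads.word [] q r
  | set σ =>
    have ho : (occupiedC (.param 0)).eval m x y z ↔ (w (x 0)).isSome :=
      (Cond.eval_aux (a := fun _ => x 0) fun _ => eval_param x).trans (hI.occupied (x 0))
    by_cases h : (w (x 0)).isSome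
    · refine (Cond.eval_cases_pos (ho.2 h)).trans ((hI.reads_letterC (eval_param x) q r).trans ?_)
      obtain ⟨τ, hτ⟩ := Option.isSome_iff_exists.1 h
      rw [hτ]; rfl
    · refine (Cond.eval_cases_neg (ho.not.2 h)).trans ((Reads.word [σ] q r).trans ?_)
      rw [Option.not_isSome_iff_eq_none.1 h]; rfl

/-- The parts of the segment on both sides of the changed block contain no changed position, so
their old transitions remain valid; only the block itself needs the new conditions `X`. -/
theorem reads_spliceC {c : WordChange α} {j : ℕ} (hj : j ≤ d)
    {X : Q → Q → Cond (ctx.{u} d Q) 1 l k}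
    (hX : ∀ e : Fin n, (e : ℕ) = blockEnd (fanout d n ^ j) (x 0) → Reads D m x y z X
      (factor (changeWord c (x 0) w) (blockStart (fanout d n ^ j) (x 0)) e))
    {a b : Fin n} (hs : s.eval m x y z = some a) (ht : t.eval m x y z = some b)
    (hab : Aligned (fanout d n ^ j) (fanout d n ^ (j + 1)) a b) (ha : a ≤ x 0) (hb : x 0 < b) :
    Reads D m x y z (spliceC j X s t) (factor (changeWord c (x 0) w) a b) := by
  -- As `a` and `b` are block borders of level `j`, the whole block of the changed position lies
  -- between them; its end is hence in the domain.
  have ha' := le_blockStart hab.left (Fin.le_def.1 ha)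
  have hb' := blockEnd_le hab.right (Fin.lt_def.1 hb)
  have hlt := lt_blockEnd (Nat.pow_pos (n := j) (fanout_pos d n)) (x 0)
  have hle := blockStart_le (fanout d n ^ j) (x 0)
  set i : Fin n := ⟨blockStart (fanout d n ^ j) (x 0), hle.trans_lt (x 0).isLt⟩ with hi
  set e : Fin n := ⟨blockEnd (fanout d n ^ j) (x 0), hb'.trans_lt b.isLt⟩ with he
  have hie : (i : ℕ) ≤ e := hle.trans hlt.le
  have hsi := hI.eval_startT (j := j) (b := i) (hj.trans (Nat.le_succ d))
    (eval_param (y := y) (z := z) x) rfl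
  have hse := hI.eval_finishT (j := j) (b := e) (hj.trans (Nat.le_succ d))
    (eval_param (y := y) (z := z) x) rfl
  rw [← factor_append _ (show (a : ℕ) ≤ i from ha') (hie.trans hb'), ← factor_append _ hie hb']
  refine Reads.comp ?_ (.comp (hX e rfl) ?_)
  · rw [changeWord, factor_update _ _ _ fun h => absurd h.2 (not_lt.2 hle)]
    exact hI.reads_segmentC hj hs hsi
      (hab.take (dvd_blockStart _ _) ha' (hie.trans hb'))
  · rw [changeWord, factor_update _ _ _ fun h => absurd h.1 (not_le.2 hlt)]
    exact hI.reads_segmentC hj hse ht (hab.drop (dvd_blockEnd _ _) (ha'.trans hie) hb')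

/-- A block of level `j + 1` is a full run of level-`j` blocks, so splicing applies to it. The
recursion down to the single letter is needed because the updated relations of lower levels are not
yet visible to the rule. -/
theorem reads_blockC (c : WordChange α) {j : ℕ} (hj : j ≤ d + 1) (e : Fin n)
    (he : (e : ℕ) = blockEnd (fanout d n ^ j) (x 0)) : Reads D m x y z (blockC D c j)
      (factor (changeWord c (x 0) w) (blockStart (fanout d n ^ j) (x 0)) e) := by
  induction j generalizing e with
  | zero =>
    -- A block of level `0` is the changed position alone.
    simp only [pow_zero, blockEnd, blockStart, Nat.div_one, mul_one] at he ⊢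
    rw [he, factor_succ, changeWord, Function.update_self]
    exact hI.reads_newLetterC c
  | succ j ih =>
    have hdvd : fanout d n ^ j ∣ fanout d n ^ (j + 1) := pow_dvd_pow _ (Nat.le_succ j)
    have hlt := lt_blockEnd (Nat.pow_pos (n := j + 1) (fanout_pos d n)) (x 0)
    have hle := blockStart_le (fanout d n ^ (j + 1)) (x 0)
    refine hI.reads_spliceC (a := ⟨_, hle.trans_lt (x 0).isLt⟩) (by omega)
      (fun e he => ih (by omega) e he) (hI.eval_startT hj (eval_param x) rfl)
      (hI.eval_finishT hj (eval_param x) he)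
      ⟨hdvd.trans (dvd_blockStart _ _), he ▸ hdvd.trans (dvd_blockEnd _ _),
        he ▸ hle.trans hlt.le, ?_⟩ hle (Fin.lt_def.2 (he ▸ hlt))
    rw [he, blockEnd_eq, blockEnd_eq]
    exact Nat.add_le_add_right (le_blockStart (dvd_blockStart _ _) le_rfl) _

theorem eval_newSegmentC (c : WordChange α) {j : ℕ} (hj : j ≤ d) {y : Fin 2 → Fin n}
    {a b : Fin n} (hs : (leftT j).eval m x y Fin.elim0 = some a)
    (ht : (rightT j).eval m x y Fin.elim0 = some b)
    (hab : Aligned (fanout d n ^ j) (fanout d n ^ (j + 1)) a b) :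
    Reads D m x y Fin.elim0 (newSegmentC D c j) (factor (changeWord c (x 0) w) a b) := by
  intro q r
  have hc : (Cond.and (.le (leftT j) (.param 0)) (.not (.le (rightT j) (.param 0)))).eval
      m x y Fin.elim0 ↔ a ≤ x 0 ∧ x 0 < b := by
    simp only [Cond.eval, ← not_le (a := b)]
    rw [← Cond.eval_le hs (eval_param x), ← Cond.eval_le ht (eval_param x)]
    simp only [Cond.eval]
  by_cases h : a ≤ x 0 ∧ x 0 < b
  · exact (Cond.eval_cases_pos (hc.2 h)).trans (hI.reads_spliceC hj
      (fun e he => hI.reads_blockC c (by omega) e he) hs ht hab h.1 h.2 q r)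
  · rw [changeWord, factor_update _ _ _ h]
    exact (Cond.eval_cases_neg (hc.not.2 h)).trans (hI.reads_segmentC hj hs ht hab q r)

/-- The update reaches every stored run that the change can affect: such a run lies in the level-`(j
+ 1)` block of the changed position and is given by the numbers, within this block, of its first and
last level-`j` blocks. -/
theorem exists_index {j : ℕ} (hj : j ≤ d) {a b : Fin n}
    (hab : Aligned (fanout d n ^ j) (fanout d n ^ (j + 1)) a b) (ha : a ≤ x 0) (hb : x 0 < b) :
    ∃ y : Fin 2 → Fin n, (∀ i, (y i : ℕ) ≤ rootBelow d n) ∧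
      (leftT j).eval m x y Fin.elim0 = some a ∧ (rightT j).eval m x y Fin.elim0 = some b := by
  have hpos := Nat.pow_pos (n := j) (fanout_pos d n)
  have hpos' := Nat.pow_pos (n := j + 1) (fanout_pos d n)
  have hdvd : fanout d n ^ j ∣ fanout d n ^ (j + 1) := pow_dvd_pow _ (Nat.le_succ j)
  have hle := blockStart_le (fanout d n ^ (j + 1)) (x 0)
  have ha' := Fin.le_def.1 ha
  have hb' := Fin.lt_def.1 hb
  -- If the block of `x 0` started after `a`, the block of `a` would end at or before `x 0 < b`,
  -- contrary to the alignment.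
  have hst : blockStart (fanout d n ^ (j + 1)) (x 0) = blockStart (fanout d n ^ (j + 1)) a := by
    refine le_antisymm ?_ (le_blockStart (dvd_blockStart _ _) ((blockStart_le _ _).trans ha'))
    by_contra h
    have := blockEnd_le (dvd_blockStart (fanout d n ^ (j + 1)) (x 0))
      (not_le.1 fun h' => h (le_blockStart (dvd_blockStart _ _) h'))
    have := hab.le_blockEnd
    omega
  have hend := hab.le_blockEnd
  rw [blockEnd_eq, ← hst] at hend
  have hsa : blockStart (fanout d n ^ (j + 1)) (x 0) ≤ a := hst ▸ blockStart_le _ _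
  obtain ⟨i, hi⟩ : ∃ i : Fin n, (i : ℕ) = blockStart (fanout d n ^ (j + 1)) (x 0) :=
    ⟨⟨_, hle.trans_lt (x 0).isLt⟩, rfl⟩
  have hdi : fanout d n ^ j ∣ i := hi ▸ hdvd.trans (dvd_blockStart _ _)
  have hib : (i : ℕ) + fanout d n ^ j ≤ b := by
    have := blockEnd_le hab.right (show (i : ℕ) < b by omega)
    rw [blockEnd_eq] at this
    exact (Nat.add_le_add_right (le_blockStart hdi le_rfl) _).trans this
  rw [← hi] at hle hend hsa
  rw [pow_succ] at hend
  obtain ⟨y0, h0, h0'⟩ := exists_digit (K := fanout d n) hdi hab.left hsa (by omega)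
  -- The second index is the number of the last block of the run, not of the border `b`: when `b`
  -- ends the large block, its own number would be `fanout d n`, one beyond the index range.
  obtain ⟨y1, h1, h1'⟩ := exists_digit (a := b - fanout d n ^ j) (K := fanout d n) hdi
    (Nat.dvd_sub hab.right dvd_rfl) (by omega) (by omega)
  have hroot := rootBelow_lt (d := d) a.pos
  have hbn := b.isLt
  have hsi (y : Fin 2 → Fin n) := hI.eval_startT (j := j + 1) (b := i) (by omega)
    (eval_param (y := y) (z := Fin.elim0) x) hi
  have hix (y : Fin 2 → Fin n) (i : Fin 2) :
      (Term.index i : Term (ctx.{u} d Q) 1 2 0).eval m x y Fin.elim0 = some (y i) := by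
    simp only [Term.eval]
  simp only [fanout] at h0 h1
  refine ⟨![⟨y0, by omega⟩, ⟨y1, by omega⟩],
    Fin.forall_fin_two.2 ⟨Nat.lt_succ_iff.1 h0, Nat.lt_succ_iff.1 h1⟩, ?_, ?_⟩
  · exact Term.eval_add (b := ⟨y0 * fanout d n ^ j, by omega⟩) h0' (hsi _)
      (hI.eval_scaleT j (hix _ 0) rfl)
  · refine hI.eval_finishT (a := ⟨b - fanout d n ^ j, by omega⟩) (by omega)
      (Term.eval_add (b := ⟨y1 * fanout d n ^ j, by omega⟩) h1' (hsi _)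
        (hI.eval_scaleT j (hix _ 1) rfl)) ?_
    -- The last block starts at the multiple `b - fanout d n ^ j` of the block size, so `finishT`
    -- leads exactly to `b`.
    obtain ⟨q, hq⟩ := Nat.dvd_sub hab.right (dvd_refl (fanout d n ^ j))
    simp only [hq, blockEnd, Nat.mul_div_cancel_left q hpos]
    rw [add_mul, one_mul, mul_comm q, ← hq]
    omega

end Invariant

end Update

end Preservation

-- Correctness and work of the whole program.

section Correctness

variable {d : ℕ} {Q : Type} [Fintype Q] {α : Type u} [Finite α] (D : DFA α Q)

/-- The values of terms depend only on the auxiliary structure and the assigned symbols. -/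
theorem eval_eq_of_aux_eq {p l k n : ℕ}
    {M M' : (i : (ctx.{u} d Q).Inst) → Execution ((ctx.{u} d Q).sig i) n}
    (m : Memory (ctx.{u} d Q) n M) (m' : Memory (ctx.{u} d Q) n M') (haux : m.aux = m'.aux)
    (hstore : m.store = m'.store) (t : Term (ctx.{u} d Q) p l k) (x : Fin p → Fin n)
    (y : Fin l → Fin n) (z : Fin k → Fin n) : t.eval m x y z = t.eval m' x y z := by
  obtain rfl : M = M' := funext fun i => Empty.elim i
  obtain ⟨a, s, i⟩ := m
  obtain ⟨a', s', i'⟩ := m'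
  obtain rfl : a = a' := haux
  obtain rfl : s = s' := hstore
  obtain rfl : i = i' := funext fun i => Empty.elim i
  rfl

section Execution

variable {n : ℕ} (M : (i : (ctx.{u} d Q).Inst) → Execution ((ctx.{u} d Q).sig i) n)

open Classical in
theorem realize_ite {ι : Type} (P : Prop) (v : ι → Fin n) :
    (if P then ⊤ else ⊥ : arith.Formula ι).Realize v ↔ P := by
  split <;> simp_all

/-- Initially all factors are empty, so every stored transition relation is the identity, on all
levels and at all positions. Function values outside of the domain stay undefined, and the invariant
does not ask for them. -/
theorem invariant_init :
    Invariant D (fun _ : Fin n => none) ((rules (Q := Q) D d).initStr n) where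
  value f a b hb := by
    have hf := (AuxFun.uniformlyDefinable f).choose_spec n
    have key : ∀ e : Fin n, ((rules D d).funInit f).Realize
        (Fin.snoc (α := fun _ => Fin n) (fun _ : Fin 1 => a) e) ↔ e = b := fun e => by
      rw [Fin.ext_iff, hb]
      exact hf _
    have h : ∃! e : Fin n, ((rules D d).funInit f).Realize
        (Fin.snoc (α := fun _ => Fin n) (fun _ : Fin 1 => a) e) :=
      ⟨b, (key b).2 rfl, fun e he => (key e).1 he⟩
    exact (dif_pos h).trans (congrArg some ((key _).1 h.choose_spec.1))
  occupied a := iff_of_false (fun h => h) (by simp)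
  letter q r a := realize_ite (q = r) _
  segment _ _ q r _ _ _ := by
    rw [factor_empty]
    exact realize_ite (q = r) _

variable {M} {D} {m : Memory (ctx.{u} d Q) n M} {w : Fin n → Option α}

theorem exprRule_newRel_param {x : Fin 1 → Fin n} {e : Cond (ctx.{u} d Q) 1 0 0}
    {old : (Fin 1 → Fin n) → Prop} {a : Fin n} {P : Prop}
    (h1 : a = x 0 → (e.eval m x Fin.elim0 Fin.elim0 ↔ P)) (h2 : a ≠ x 0 → (old (fun _ => a) ↔ P)) :
    (exprRule (C := ctx.{u} d Q) (E := fun l => Cond (ctx.{u} d Q) 1 l 0) 0 Fin.elim0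
      (fun _ => Term.param (0 : Fin 1)) e).newRel old m x (fun _ => a) ↔ P := by
  refine exprRule_newRel_iff (fun y hy => ?_) fun hy => h2 fun h => ?_
  · rw [Subsingleton.elim y Fin.elim0]
    have := hy 0
    simp only [Term.eval, Option.some.injEq] at this
    exact h1 this.symm
  · exact hy ⟨Fin.elim0, fun j => j.elim0, fun j => by simp only [Term.eval, h]⟩

theorem Invariant.newRel_occupied (hI : Invariant D w m.aux) (c : WordChange α)
    (x : Fin 1 → Fin n) (a : Fin n) :
    ((rules D d).relRule c AuxRel.occupied).newRel (m.aux.rel AuxRel.occupied) m x (fun _ => a) ↔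
      (changeWord c (x 0) w a).isSome := by
  cases c with
  | set σ =>
    refine exprRule_newRel_param (fun h => ?_) fun h => ?_
    · simp only [Cond.eval, h, changeWord, Function.update_self, newLetter]
      cases w (x 0) <;> simp
    · rw [changeWord, Function.update_of_ne h]
      exact hI.occupied a
  | reset =>
    refine exprRule_newRel_param (fun h => ?_) fun h => ?_
    · simp [Cond.eval, h, changeWord, newLetter]
    · rw [changeWord, Function.update_of_ne h]
      exact hI.occupied a

theorem Invariant.newRel_letter (hI : Invariant D w m.aux) (c : WordChange α)
    (x : Fin 1 → Fin n) (q r : Q) (a : Fin n) :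
    ((rules D d).relRule c (AuxRel.letter q r)).newRel (m.aux.rel (AuxRel.letter q r)) m x
      (fun _ => a) ↔ D.evalFrom q (changeWord c (x 0) w a).toList = r := by
  have key : (exprRule (C := ctx.{u} d Q) (E := fun l => Cond (ctx.{u} d Q) 1 l 0) 0 Fin.elim0
      (fun _ => Term.param (0 : Fin 1)) (newLetterC D c q r)).newRel
      (m.aux.rel (AuxRel.letter q r)) m x (fun _ => a) ↔
      D.evalFrom q (changeWord c (x 0) w a).toList = r := by
    refine exprRule_newRel_param (fun h => ?_) fun h => ?_
    · rw [h, changeWord, Function.update_self]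
      exact hI.reads_newLetterC c q r
    · rw [changeWord, Function.update_of_ne h]
      exact hI.letter q r a
  cases c <;> exact key

/-- A position that is reached gets the correct value by `eval_newSegmentC`. One that is not reached
belongs to a run without the changed position, by `exists_index`, so its old value is still correct.
Positions that are not aligned may hold anything. -/
theorem Invariant.newRel_segment (hI : Invariant D w m.aux)
    (hstore : m.store = Store.blank _ n) (c : WordChange α)
    (x : Fin 1 → Fin n) {j : ℕ} (hj : j ≤ d) (q r : Q) {a b : Fin n}
    (hab : Aligned (fanout d n ^ j) (fanout d n ^ (j + 1)) a b) :
    ((rules D d).relRule c (AuxRel.segment (level d j) q r)).newRel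
      (m.aux.rel (AuxRel.segment (level d j) q r)) m x ![a, b] ↔
        D.evalFrom q (factor (changeWord c (x 0) w) a b) = r := by
  have key : (exprRule (C := ctx.{u} d Q) (E := fun l => Cond (ctx.{u} d Q) 1 l 0) 2
      (fun _ => ⟨rootBelow d, foDefinable_rootBelow d⟩)
      (show Fin 2 → Term (ctx.{u} d Q) 1 2 0 from ![leftT (level d j), rightT (level d j)])
      (newSegmentC D c (level d j) q r)).newRel
      (m.aux.rel (AuxRel.segment (level d j) q r)) m x ![a, b] ↔
      D.evalFrom q (factor (changeWord c (x 0) w) a b) = r := by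
    rw [level_val (hj.trans (Nat.le_succ d))]
    -- Targets are evaluated over the auxiliary structure with a blank store; this agrees with `m`,
    -- whose store is blank by `hstore`.
    have heval (y : Fin 2 → Fin n) (t : Term (ctx.{u} d Q) 1 2 0) :
        t.eval (auxMemory (C := ctx.{u} d Q) m.aux : Memory (ctx.{u} d Q) n _) x y Fin.elim0 =
          t.eval m x y Fin.elim0 :=
      eval_eq_of_aux_eq (auxMemory (C := ctx.{u} d Q) m.aux : Memory (ctx.{u} d Q) n _) m rfl
        hstore.symm t x y Fin.elim0
    refine exprRule_newRel_iff (fun y hy => ?_) fun hy => ?_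
    · exact hI.eval_newSegmentC c hj ((heval y _).symm.trans (hy (0 : Fin 2)))
        ((heval y _).symm.trans (hy (1 : Fin 2))) hab q r
    · have h : ¬ (a ≤ x 0 ∧ x 0 < b) := fun h => by
        obtain ⟨y, h1, h2, h3⟩ := hI.exists_index hj hab h.1 h.2
        exact hy ⟨y, h1, Fin.forall_fin_two.2
          ⟨(heval y _).trans h2, (heval y _).trans h3⟩⟩
      rw [changeWord, factor_update _ _ _ h]
      exact hI.segment j hj q r a b hab
  cases c <;> exact key

theorem Invariant.change {s : ((rules D d).execution M).State} (hI : Invariant D w s.1)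
    (c : WordChange α) (x : Fin 1 → Fin n) :
    Invariant D (changeWord c (x 0) w) (((rules D d).execution M).change c x s).1 where
  value f a b hb :=
    (congrFun (keepRule_newFun (C := ctx.{u} d Q) (p := 1) (a := 0) (m := startMemory M s) (x := x)
      (s.1.fn f)) _).trans (hI.value f a b hb)
  occupied a := newRel_occupied (m := startMemory M s) hI c x a
  letter q r a := newRel_letter (m := startMemory M s) hI c x q r a
  segment _ hj q r _ _ hab := newRel_segment (m := startMemory M s) hI rfl c x hj q r hab

theorem Invariant.foldl (ops : List ((c : (rangeMemberSig α).Change) ×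
      (Fin ((rangeMemberSig α).changeArity c) → Fin n)))
    {s : ((rules D d).execution M).State} (hI : Invariant D w s.1) (L : Language α) :
    Invariant D (ops.foldl (fun s op => (rangeMember L n).change op.1 op.2 s) w)
      (ops.foldl (fun s op => ((rules D d).execution M).change op.1 op.2 s) s).1 := by
  induction ops generalizing w s with
  | nil => exact hI
  | cons op ops ih =>
    obtain ⟨c, x⟩ := op
    have h := hI.change c x
    cases c <;> exact ih h

variable (D)

theorem relRule_okRel (c : WordChange α) (R : AuxRel d Q) (x : Fin 1 → Fin n) :
    ((rules D d).relRule c R).OkRel m x := by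
  have hparam (e : Cond (ctx.{u} d Q) 1 0 0) (he : e.Simple) :
      (exprRule (C := ctx.{u} d Q) (E := fun l => Cond (ctx.{u} d Q) 1 l 0) 0 Fin.elim0
        (fun _ : Fin 1 => Term.param (0 : Fin 1)) e).OkRel m x :=
    exprRule_okRel (fun _ => .param 0) he
  cases R with
  | occupied =>
    cases c
    exacts [hparam _ .tt, hparam _ (.not .tt)]
  | letter q r =>
    have h := hparam _ (newLetterC_simple D c q r)
    cases c <;> exact h
  | segment j q r =>
    have h : (exprRule (C := ctx.{u} d Q) (E := fun l => Cond (ctx.{u} d Q) 1 l 0) 2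
      (fun _ => ⟨rootBelow d, foDefinable_rootBelow d⟩)
      (show Fin 2 → Term (ctx.{u} d Q) 1 2 0 from ![leftT j, rightT j])
      (newSegmentC D c j q r)).OkRel m x :=
      exprRule_okRel (Fin.forall_fin_two.2 ⟨leftT_simple j, rightT_simple j⟩)
        (newSegmentC_simple D c j q r)
    cases c <;> exact h

variable (M)

theorem relRule_work_le (c : WordChange α) (R : AuxRel d Q) :
    ((rules D d).relRule c R).work M (Cond.work M) ≤ fanout d n ^ 2 := by
  have h1 : 1 ≤ fanout d n ^ 2 := Nat.pow_pos (fanout_pos d n)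
  have hparam (e : Cond (ctx.{u} d Q) 1 0 0) (he : e.Simple) :
      (exprRule (C := ctx.{u} d Q) (E := fun l => Cond (ctx.{u} d Q) 1 l 0) 0 Fin.elim0
        (fun _ : Fin 1 => Term.param (0 : Fin 1)) e).work M (Cond.work M) ≤ fanout d n ^ 2 :=
    (exprRule_work_le _ (fun _ => .param 0) (he n M).2).trans (by simpa using h1)
  cases R with
  | occupied =>
    cases c
    exacts [hparam _ .tt, hparam _ (.not .tt)]
  | letter q r =>
    have h := hparam _ (newLetterC_simple D c q r)
    cases c <;> exact h
  | segment j q r =>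
    have h : (exprRule (C := ctx.{u} d Q) (E := fun l => Cond (ctx.{u} d Q) 1 l 0) 2
      (fun _ => ⟨rootBelow d, foDefinable_rootBelow d⟩)
      (show Fin 2 → Term (ctx.{u} d Q) 1 2 0 from ![leftT j, rightT j])
      (newSegmentC D c j q r)).work M (Cond.work M) ≤ fanout d n ^ 2 := by
      refine (exprRule_work_le (C := ctx.{u} d Q) (E := fun l => Cond (ctx.{u} d Q) 1 l 0)
        (e := newSegmentC D c j q r) (Cond.work M) ?_
        (newSegmentC_simple D c j q r n M).2).trans ?_
      · exact Fin.forall_fin_two.2 ⟨leftT_simple j, rightT_simple j⟩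
      -- Two index variables, each with `rootBelow d n + 1` values.
      · rw [Finset.prod_const, Finset.card_univ, Fintype.card_fin, fanout]
    cases c <;> exact h

theorem changeWork_le (c : WordChange α) :
    ((rules D d).execution M).changeWork c ≤ fanout d n ^ 2 := by
  refine max_le (Finset.sup_le fun R _ => relRule_work_le D M c R) (Finset.sup_le fun f _ => ?_)
  exact (keepRule_work_le (C := ctx.{u} d Q) (p := 1) (a := 0) (M := M)).trans
    (Nat.pow_pos (fanout_pos d n))

end Execution

/-- The program for range membership. -/
noncomputable def program (d : ℕ) : Program (rangeMemberSig α) :=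
  .mk (ctx.{u} d Q) (fun i => Empty.elim i) (rules D d) fun _ i => Empty.elim i

theorem program_execution (n : ℕ) : (program D d).execution n =
    (rules D d).execution fun i => (Empty.elim i : Program _).execution n :=
  rfl

theorem program_isProgramFor : (program D d).IsProgramFor (rangeMember D.accepts) := by
  intro n ops
  rw [program_execution]
  have hI := (invariant_init (d := d) (n := n) D).foldl (s := ((rules D d).execution
    fun i => (Empty.elim i : Program _).execution n).init) ops D.accepts
  refine ⟨fun c x => ⟨fun R => relRule_okRel D c R x, fun f => keepRule_okFun⟩, fun q x => ⟨?_, ?_⟩,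
    fun q => q.elim⟩
  · exact ⟨trivial, (queryC_simple D n _).1 _ _ _ _⟩
  · exact Invariant.eval_queryC (m := startMemory _ _) hI

/-- The root is at most `n ^ (1 / (d + 1))`, and `1 / (d + 1) ≤ ε / 2`; squaring yields the exponent
`ε`. -/
theorem fanout_sq_isBigO {d : ℕ} {ε : ℝ} (hd : 2 / ε ≤ d + 1) (hε : 0 < ε) :
    (fun n : ℕ => ((fanout d n ^ 2 : ℕ) : ℝ)) =O[Filter.atTop] fun n : ℕ => (n : ℝ) ^ ε := by
  -- The constant is the square of `2`: for `n ≥ 1`, the summand `1` in the fanout is also at most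
  -- `n ^ (ε / 2)`.
  refine Asymptotics.IsBigO.of_bound 4 ?_
  filter_upwards [Filter.eventually_ge_atTop 1] with n hn
  have hn' : (1 : ℝ) ≤ n := by exact_mod_cast hn
  have hpow : (1 : ℝ) ≤ (n : ℝ) ^ (ε / 2) := Real.one_le_rpow hn' (by positivity)
  have hroot : (rootBelow d n : ℝ) ≤ (n : ℝ) ^ (ε / 2) := by
    have h1 : (rootBelow d n : ℝ) ^ (d + 1) ≤ n := by
      exact_mod_cast ((le_rootBelow_iff (d := d) hn).1 le_rfl).le
    -- Comparing powers with exponent `d + 1` leaves `n ≤ n ^ (ε / 2 * (d + 1))`, where the exponent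
    -- is at least `1` by `hd`.
    refine le_of_pow_le_pow_left₀ (Nat.succ_ne_zero d) (by positivity) (h1.trans ?_)
    rw [← Real.rpow_natCast, ← Real.rpow_mul (by positivity)]
    conv_lhs => rw [← Real.rpow_one (n : ℝ)]
    refine Real.rpow_le_rpow_of_exponent_le hn' ?_
    rw [div_le_iff₀ hε] at hd
    push_cast
    linarith
  have h2 : ((n : ℝ) ^ (ε / 2)) ^ 2 = (n : ℝ) ^ ε := by
    rw [← Real.rpow_natCast, ← Real.rpow_mul (by positivity)]
    norm_num
  rw [Real.norm_of_nonneg (by positivity), Real.norm_of_nonneg (by positivity), ← h2]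
  calc ((fanout d n ^ 2 : ℕ) : ℝ) = ((rootBelow d n : ℝ) + 1) ^ 2 := by simp [fanout]
    _ ≤ (2 * (n : ℝ) ^ (ε / 2)) ^ 2 := by gcongr; linarith
    _ = 4 * ((n : ℝ) ^ (ε / 2)) ^ 2 := by ring

theorem program_hasWork {ε : ℝ} (hd : 2 / ε ≤ d + 1) (hε : 0 < ε) :
    (program (d := d) D).HasWork fun n : ℕ => (n : ℝ) ^ ε := by
  have key : ∀ W : ℕ → ℕ, (∀ n, W n ≤ fanout d n ^ 2) →
      (fun n => (W n : ℝ)) =O[Filter.atTop] fun n : ℕ => (n : ℝ) ^ ε := fun W hW =>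
    (Asymptotics.IsBigO.of_norm_le fun n => by
      rw [Real.norm_natCast]
      exact_mod_cast hW n).trans (fanout_sq_isBigO hd hε)
  refine ⟨fun c => key (fun n => ((program D d).execution n).changeWork c)
    fun n => changeWork_le D _ c, fun q => key (fun n => ((program D d).execution n).relQueryWork q)
    fun n => ?_, fun q => q.elim⟩
  exact ((queryC_simple D n _).2).trans (Nat.pow_pos (fanout_pos d n))

end Correctness

end RangeMember

end DynFO

theorem mainTheorem1 {α : Type u} [Finite α] (L : Language α) (hL : L.IsRegular)
    (ε : ℝ) (hε : 0 < ε) :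
    DynFO.MaintainableWithWork (DynFO.rangeMember L) (fun n : ℕ => (n : ℝ) ^ ε) := by
  obtain ⟨Q, _, D, rfl⟩ := hL
  -- The number of levels depends on `ε` only: any `d` with `2 / ε ≤ d + 1` would do.
  exact ⟨DynFO.RangeMember.program D ⌈2 / ε⌉₊, DynFO.RangeMember.program_isProgramFor D,
    DynFO.RangeMember.program_hasWork D ((Nat.le_ceil _).trans (by simp)) hε⟩
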